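/- **Setting.** A *hypersurface* is a compact oriented topological 1-manifold, possibly with boundary, and a *region* is a compact oriented topological surface, possibly with boundary; $\overline{\,\cdot\,}$ denotes orientation reversal. A *gluing function* is a closed continuous orientation preserving surjection that is an embedding on the interior. A *relative gluing diagram* consists of gluing functions $\alpha:\Sigma\sqcup\overline\Sigma\sqcup\Lambda\to\partial X$, $f:X\to X'$ and $\beta:\Lambda\to\partial X'$ such that $f$ is the coequalizer of the two inclusions of $\Sigma$ in $X$ given by $\alpha$, and $\beta$ is the restriction of $f$ along $\alpha|_\Lambda$. A *slice region* on $\Sigma$ is a region $S$ with a gluing function $s:\overline\Sigma\sqcup\Sigma\to\partial S$ such that gluing $S$ along $\Sigma$ (at either end) to any region $X$ whose boundary is decomposed as $\Sigma\sqcup\Gamma\to\partial X$ gives back $X$ with the same boundary decomposition; the slice region of a circle is the cylinder. Consider a symmetric, possibly infinite-dimensional, compositional quantum field theory (CQFT) in dimension $2$, on a system of admissible hypersurfaces, regions, gluing functions, gluing diagrams and slice regions. It consists of: super Krein spaces $\mathcal H_\Sigma$ with dense graded subspaces $\mathcal H_\Sigma^\circ$ and $\mathcal H_\emptyset=\mathbb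 C$; antilinear graded involutions $\iota_\Sigma:\mathcal H_\Sigma\to\mathcal H_{\overline\Sigma}$; graded isomorphisms $\tau:\mathcal H_{\Sigma_1}\otimes\mathcal H_{\Sigma_2}\to\mathcal H_{\Sigma_1\sqcup\Sigma_2}$; graded epimorphisms $\gamma_f:\mathcal H_\Sigma\to\mathcal H_{\Sigma'}$ for gluing functions $f:\Sigma\to\Sigma'$, isomorphisms if $f$ is a homeomorphism, with $\gamma_{\mathrm{id}}=\mathrm{id}$; and graded linear amplitude maps $\rho_X:\mathcal H_{\partial X}^\circ\to\mathbb C$ with $\rho_\emptyset=\mathrm{id}$. All structure maps respect the subspaces $\mathcal H^\circ$. The axioms are: $\tau$ is associative; $\gamma$ sends commuting squares to commuting squares; $\tau(\iota a\otimes\iota b)=\iota\,\tau(b\otimes a)$ (identifying $\overline{\Sigma_1}\sqcup\overline{\Sigma_2}$ with $\overline{\Sigma_2\sqcup\Sigma_1}$); $\gamma_{f_1\sqcup f_2}\tau=\tau(\gamma_{f_1}\otimes\gamma_{f_2})$; $\iota\gamma_f=\gamma_{\overline f}\iota$; $\rho_{X_1\sqcup X_2}\tau=\rho_{X_1}\otimes\rho_{X_2}$;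 $\rho_{\overline X}\iota=\overline{\rho_X}$; $\rho_{X'}\gamma_{f|_{\partial X}}=\rho_X$ for homeomorphisms $f:X\to X'$; for every slice region $(S,s)$ on $\Sigma$ the form $$\langle v,w\rangle_\Sigma=\rho_S\big(\gamma_s\,\tau(\iota_\Sigma(v)\otimes w)\big)$$ is defined on all of $\mathcal H_\Sigma$ and is a non-degenerate continuous form (represented by an isomorphism); for every relative gluing diagram as above there is an anomaly $c_{f,\beta}\neq0$, equal to $1$ for diagrams coming from homeomorphisms, such that for every homogeneous orthonormal basis $\{\zeta_k\}$ of $\mathcal H_\Sigma$ (that is, $\langle\zeta_k,\zeta_l\rangle=(-1)^{[\zeta_k]}\delta_{kl}$, and $\mathcal H_\Sigma$ is the sum of the closed spans of the positive and of the negative basis vectors) and every $v\in\mathcal H_\Lambda^\circ$ $$\rho_{X'}(\gamma_\beta v)=c_{f,\beta}\sum_k(-1)^{[\zeta_k]}\rho_X\gamma_\alpha\tau(\zeta_k\otimes\iota\zeta_k\otimes v),$$ all arguments of $\rho_X$ lying in $\mathcal H_{\partial X}^\circ$; and, by symmetry, $\tau(a\otimes b)=(-1)^{|a||b|}\tau(b\otimes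 a)$ under $\Sigma_1\sqcup\Sigma_2=\Sigma_2\sqcup\Sigma_1$. In finite dimension $\mathcal H^\circ=\mathcal H$. Fix an interval $I$, a disc $D$ with boundary circle $C=\partial D$, gluing functions $f_2:I\sqcup I\to I$ and $f_{I,C}:I\to C$, and orientation preserving homeomorphisms $t_I:I\to\overline I$, $t_C:C\to\overline C$ that are inverse to their orientation reversals and satisfy $t_C f_{I,C}=\overline{f_{I,C}}\,t_I$ and $t_I f_2=\overline{f_2}\circ\mathrm{swap}\circ(t_I\sqcup t_I)$, with $D$, $f_2$, $f_{I,C}$ admissible. Put $f_4=f_2(\mathrm{id}\sqcup f_2)(\mathrm{id}\sqcup\mathrm{id}\sqcup f_2)$, $\gamma_{I,C}=\gamma_{f_{I,C}}$, $\gamma_4=\gamma_{f_4}\circ\tau$, $\alpha_I=\iota_{\overline I}\gamma_{t_I}$ and $\alpha_C=\iota_{\overline C}\gamma_{t_C}$. Let $c_{\mathrm{Cyl}}$ be the anomaly of an admissible relative gluing diagram that glues $D$ to itself to give the cylinder $\mathrm{Cyl}$, the slice region of $C$ with boundary decomposition $s:\overline C\sqcup C\to\partial\,\mathrm{Cyl}$: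 here $\Sigma=I$, $\Lambda=\overline I\sqcup I$, $$\alpha=f_{I,C}\circ f_4\circ(\mathrm{id}_1\sqcup\sigma_{23}\sqcup\mathrm{id}_4)\circ(\mathrm{id}_1\sqcup\overline{t_I}\sqcup\overline{t_I}\sqcup\mathrm{id}_4)\ \text{ on } I_1\sqcup\overline{I_2}\sqcup\overline{I_3}\sqcup I_4,\qquad \beta=s\circ(\overline{f_{I,C}}\sqcup f_{I,C}).$$ **Proposition.** (1) For every homogeneous orthonormal basis $\{\zeta_k\}$ of $\mathcal H_I$, every homogeneous $v\in\mathcal H_I^\circ$ and every $v'\in\mathcal H_I^\circ$, the vectors $\gamma_{I,C}\gamma_4(\zeta_k\otimes\alpha_I(v)\otimes\alpha_I(\zeta_k)\otimes v')$ lie in $\mathcal H_C^\circ$, and, the sum being unconditionally convergent, $$\langle\gamma_{I,C}(v),\gamma_{I,C}(v')\rangle_C=c_{\mathrm{Cyl}}\sum_k(-1)^{[\zeta_k]+|\zeta_k||v|}\,\rho_D\Big(\gamma_{I,C}\,\gamma_4\big(\zeta_k\otimes\alpha_I(v)\otimes\alpha_I(\zeta_k)\otimes v'\big)\Big).$$ (2)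 $\alpha_C$ is a conjugate-linear, parity preserving involution of $\mathcal H_C$, and for homogeneous $\psi,\eta\in\mathcal H_C$ $$\langle\alpha_C(\psi),\alpha_C(\eta)\rangle_C=(-1)^{|\psi||\eta|}\langle\eta,\psi\rangle_C=(-1)^{|\psi||\eta|}\,\overline{\langle\psi,\eta\rangle_C}.$$ The inner products may be computed with any admissible slice region. -/

import Mathlib

universe u

noncomputable section

namespace CQFT

open Topology

/-! ### Embedded arcs and discs, and orientations -/

/-- Continuous injective maps `K → M` (topological embeddings when `K` is compact and `M` is
Hausdorff). -/
abbrev Emb (K M : Type) [TopologicalSpace K] [TopologicalSpace M] : Type :=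
  {a : C(K, M) // Function.Injective a}

/-- Precomposition with a self-embedding. -/
def Emb.comp {K M : Type} [TopologicalSpace K] [TopologicalSpace M] (a : Emb K M) (g : Emb K K) :
    Emb K M :=
  ⟨a.1.comp g.1, a.2.comp g.2⟩

/-- A coherent choice of sign for all embeddings of a model piece `K` into `M`: every embedding is
either positive or negative, and reparametrisation by a self-embedding of `K` keeps the sign if this
self-embedding preserves the orientation of the model (predicate `P`), and changes it otherwise. -/
structure LocOrient (K : Type) [TopologicalSpace K] (P : Emb K K → Prop)
    (M : Type) [TopologicalSpace M] where
  pos : Emb K M → Prop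
  neg : Emb K M → Prop
  neg_iff : ∀ a, neg a ↔ ¬ pos a
  pos_comp : ∀ a g, pos (a.comp g) ↔ (pos a ↔ P g)

namespace LocOrient

variable {K : Type} [TopologicalSpace K] {P : Emb K K → Prop}
variable {M M₁ M₂ M₃ : Type} [TopologicalSpace M] [TopologicalSpace M₁] [TopologicalSpace M₂]
  [TopologicalSpace M₃]

/-- The opposite orientation. -/
def rev (o : LocOrient K P M) : LocOrient K P M where
  pos := o.neg
  neg := o.pos
  neg_iff a := by rw [o.neg_iff, not_not]
  pos_comp a g := by rw [o.neg_iff, o.neg_iff, o.pos_comp a g]; tauto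

/-- A predicate on embeddings into a disjoint union, given by predicates on the embeddings into the
two summands. -/
def sumPred (p : Emb K M₁ → Prop) (q : Emb K M₂ → Prop) (a : Emb K (M₁ ⊕ M₂)) : Prop :=
  (∃ a₁ : Emb K M₁, (∀ t, a.1 t = Sum.inl (a₁.1 t)) ∧ p a₁) ∨
    (∃ a₂ : Emb K M₂, (∀ t, a.1 t = Sum.inr (a₂.1 t)) ∧ q a₂)

theorem lift_sum [ConnectedSpace K] (a : Emb K (M₁ ⊕ M₂)) :
    (∃ a₁ : Emb K M₁, ∀ t, a.1 t = Sum.inl (a₁.1 t)) ∨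
      (∃ a₂ : Emb K M₂, ∀ t, a.1 t = Sum.inr (a₂.1 t)) := by
  have hc : IsPreconnected (Set.range a.1) := isPreconnected_range a.1.continuous
  obtain ⟨k₀⟩ := (inferInstance : Nonempty K)
  rcases h0 : a.1 k₀ with x | x
  · left
    have hsub : Set.range a.1 ⊆ Set.range Sum.inl :=
      hc.subset_isClopen (isClopen_range_inl (Y := M₂)) ⟨_, ⟨k₀, rfl⟩, x, h0.symm⟩
    choose b hb using fun t => hsub ⟨t, rfl⟩
    refine ⟨⟨⟨b, ?_⟩, ?_⟩, fun t => (hb t).symm⟩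
    · rw [(IsEmbedding.inl (Y := M₂)).continuous_iff]
      convert a.1.continuous using 1
      funext t; exact hb t
    · intro s t hst
      apply a.2
      change b s = b t at hst
      rw [← hb s, ← hb t, hst]
  · right
    have hsub : Set.range a.1 ⊆ Set.range Sum.inr :=
      hc.subset_isClopen (isClopen_range_inr (X := M₁)) ⟨_, ⟨k₀, rfl⟩, x, h0.symm⟩
    choose b hb using fun t => hsub ⟨t, rfl⟩
    refine ⟨⟨⟨b, ?_⟩, ?_⟩, fun t => (hb t).symm⟩
    · rw [(IsEmbedding.inr (X := M₁)).continuous_iff]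
      convert a.1.continuous using 1
      funext t; exact hb t
    · intro s t hst
      apply a.2
      change b s = b t at hst
      rw [← hb s, ← hb t, hst]

theorem sumPred_inl [ConnectedSpace K] {p : Emb K M₁ → Prop} {q : Emb K M₂ → Prop}
    {a : Emb K (M₁ ⊕ M₂)} {a₁ : Emb K M₁} (h : ∀ t, a.1 t = Sum.inl (a₁.1 t)) :
    sumPred p q a ↔ p a₁ := by
  obtain ⟨k₀⟩ := (inferInstance : Nonempty K)
  constructor
  · rintro (⟨b, hb, hp⟩ | ⟨b, hb, -⟩)
    · have : b = a₁ := Subtype.ext (ContinuousMap.ext fun t =>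
        Sum.inl_injective ((hb t).symm.trans (h t)))
      exact this ▸ hp
    · exact absurd ((hb k₀).symm.trans (h k₀)) (by simp)
  · exact fun hp => Or.inl ⟨a₁, h, hp⟩

theorem sumPred_inr [ConnectedSpace K] {p : Emb K M₁ → Prop} {q : Emb K M₂ → Prop}
    {a : Emb K (M₁ ⊕ M₂)} {a₂ : Emb K M₂} (h : ∀ t, a.1 t = Sum.inr (a₂.1 t)) :
    sumPred p q a ↔ q a₂ := by
  obtain ⟨k₀⟩ := (inferInstance : Nonempty K)
  constructor
  · rintro (⟨b, hb, -⟩ | ⟨b, hb, hp⟩)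
    · exact absurd ((hb k₀).symm.trans (h k₀)) (by simp)
    · have : b = a₂ := Subtype.ext (ContinuousMap.ext fun t =>
        Sum.inr_injective ((hb t).symm.trans (h t)))
      exact this ▸ hp
  · exact fun hp => Or.inr ⟨a₂, h, hp⟩

/-- The orientation of a disjoint union. -/
def sum [ConnectedSpace K] (o₁ : LocOrient K P M₁) (o₂ : LocOrient K P M₂) :
    LocOrient K P (M₁ ⊕ M₂) where
  pos := sumPred o₁.pos o₂.pos
  neg := sumPred o₁.neg o₂.neg
  neg_iff a := by
    rcases lift_sum a with ⟨b, hb⟩ | ⟨b, hb⟩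
    · rw [sumPred_inl hb, sumPred_inl hb, o₁.neg_iff]
    · rw [sumPred_inr hb, sumPred_inr hb, o₂.neg_iff]
  pos_comp a g := by
    rcases lift_sum a with ⟨b, hb⟩ | ⟨b, hb⟩
    · rw [sumPred_inl hb, sumPred_inl (a₁ := b.comp g) (fun t => hb _), o₁.pos_comp b g]
    · rw [sumPred_inr hb, sumPred_inr (a₂ := b.comp g) (fun t => hb _), o₂.pos_comp b g]

/-- The orientation of the empty space. -/
def empty [Nonempty K] : LocOrient K P Empty where
  pos _ := False
  neg _ := False
  neg_iff a := (a.1 (Classical.arbitrary K)).elim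
  pos_comp a := (a.1 (Classical.arbitrary K)).elim

/-- A map preserves orientation if it sends positive embedded pieces to positive ones, whenever
the image of the piece is again embedded. -/
def Preserves (o₁ : LocOrient K P M₁) (o₂ : LocOrient K P M₂) (f : M₁ → M₂) : Prop :=
  ∀ (a : Emb K M₁) (b : Emb K M₂), (∀ t, b.1 t = f (a.1 t)) → (o₂.pos b ↔ o₁.pos a)

theorem Preserves.rev {o₁ : LocOrient K P M₁} {o₂ : LocOrient K P M₂} {f : M₁ → M₂}
    (h : Preserves o₁ o₂ f) : Preserves o₁.rev o₂.rev f := fun a b hab => by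
  change o₂.neg b ↔ o₁.neg a
  rw [o₂.neg_iff, o₁.neg_iff, h a b hab]

theorem Preserves.refl (o : LocOrient K P M) : Preserves o o id := fun a b hab => by
  have : b = a := Subtype.ext (ContinuousMap.ext hab)
  rw [this]

theorem Preserves.comp {o₁ : LocOrient K P M₁} {o₂ : LocOrient K P M₂}
    {o₃ : LocOrient K P M₃} {f : M₁ → M₂} {g : M₂ → M₃} (hf : Continuous f)
    (h₁ : Preserves o₁ o₂ f) (h₂ : Preserves o₂ o₃ g) : Preserves o₁ o₃ (g ∘ f) := by
  intro a c hac
  have hinj : Function.Injective (fun t => f (a.1 t)) := fun s t hst => by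
    apply c.2
    rw [hac s, hac t]
    exact congrArg g hst
  let b : Emb K M₂ := ⟨⟨fun t => f (a.1 t), hf.comp a.1.continuous⟩, hinj⟩
  rw [h₂ b c hac, h₁ a b fun _ => rfl]

theorem preserves_inl [ConnectedSpace K] (o₁ : LocOrient K P M₁) (o₂ : LocOrient K P M₂) :
    Preserves o₁ (o₁.sum o₂) Sum.inl := fun _ _ hab => sumPred_inl hab

theorem preserves_inr [ConnectedSpace K] (o₁ : LocOrient K P M₁) (o₂ : LocOrient K P M₂) :
    Preserves o₂ (o₁.sum o₂) Sum.inr := fun _ _ hab => sumPred_inr hab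

theorem preserves_sum [ConnectedSpace K] {o₁ : LocOrient K P M₁} {o₂ : LocOrient K P M₂}
    {o : LocOrient K P M} {f : M₁ ⊕ M₂ → M} (h₁ : Preserves o₁ o (f ∘ Sum.inl))
    (h₂ : Preserves o₂ o (f ∘ Sum.inr)) : Preserves (o₁.sum o₂) o f := by
  intro a b hab
  rcases lift_sum a with ⟨c, hc⟩ | ⟨c, hc⟩
  · rw [h₁ c b fun t => by rw [hab, hc]; rfl]
    exact (sumPred_inl hc).symm
  · rw [h₂ c b fun t => by rw [hab, hc]; rfl]
    exact (sumPred_inr hc).symm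

end LocOrient

/-- The model arc `[-1, 1]`. -/
abbrev Arc : Type := Set.Icc (-1 : ℝ) 1

/-- The model disc `{z : ℂ | ‖z‖ ≤ 1}`. -/
abbrev Disc : Type := Metric.closedBall (0 : ℂ) 1

instance : Nonempty Arc := ⟨⟨0, by norm_num, by norm_num⟩⟩

instance : ConnectedSpace Arc :=
  isConnected_iff_connectedSpace.1 (isConnected_Icc (by norm_num))

instance : Nonempty Disc := ⟨⟨0, by simp⟩⟩

instance : ConnectedSpace Disc :=
  isConnected_iff_connectedSpace.1
    ⟨⟨0, by simp⟩, (convex_closedBall (0 : ℂ) 1).isPreconnected⟩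

/-- The centre of the model disc. -/
def Disc.centre : Disc := ⟨0, by simp⟩

/-- The boundary point `exp (i t)` of the model disc. -/
def Disc.rim (t : ℝ) : Disc :=
  ⟨Complex.exp (t * Complex.I), by simp [Complex.norm_exp_ofReal_mul_I]⟩

/-- The image of the boundary circle under the self-embedding `g` of the model disc winds `k` times
around the image of the centre. -/
def Turns (g : Emb Disc Disc) (k : ℤ) : Prop :=
  ∃ θ : ℝ → ℝ, Continuous θ ∧
    (∀ t, ((g.1 (Disc.rim t) : ℂ) - g.1 Disc.centre) =
      ‖(g.1 (Disc.rim t) : ℂ) - g.1 Disc.centre‖ * Complex.exp (θ t * Complex.I)) ∧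
    ∀ t, θ (t + 2 * Real.pi) = θ t + 2 * Real.pi * k

/-- Orientations of a 1-manifold: signs of embedded arcs, kept by increasing and changed by
decreasing reparametrisations. -/
abbrev Orient1 (M : Type) [TopologicalSpace M] : Type :=
  LocOrient Arc (fun g => StrictMono g.1) M

/-- Orientations of a 2-manifold: signs of embedded discs, kept by reparametrisations of positive
winding number and changed by the others (these have negative winding number). -/
abbrev Orient2 (M : Type) [TopologicalSpace M] : Type :=
  LocOrient Disc (fun g => ∃ k : ℤ, 0 < k ∧ Turns g k) M

/-! ### Hypersurfaces -/

theorem chart_push {M N B : Type} [TopologicalSpace M] [TopologicalSpace N] [TopologicalSpace B]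
    {j : M → N} (hj : IsOpenEmbedding j) (e : OpenPartialHomeomorph M B) (x : M) :
    ∃ e' : OpenPartialHomeomorph N B, e'.source = j '' e.source ∧ ∀ y, e' (j y) = e y := by
  have : Nonempty M := ⟨x⟩
  refine ⟨(hj.toOpenPartialHomeomorph j).symm.trans e, ?_, fun y => ?_⟩
  · ext z
    simp only [OpenPartialHomeomorph.trans_source, OpenPartialHomeomorph.symm_source,
      IsOpenEmbedding.toOpenPartialHomeomorph_target, Set.mem_inter_iff, Set.mem_preimage,
      Set.mem_image]
    constructor
    · rintro ⟨⟨y, rfl⟩, hy⟩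
      rw [IsOpenEmbedding.toOpenPartialHomeomorph_left_inv] at hy
      exact ⟨y, hy, rfl⟩
    · rintro ⟨y, hy, rfl⟩
      rw [IsOpenEmbedding.toOpenPartialHomeomorph_left_inv]
      exact ⟨⟨y, rfl⟩, hy⟩
  · simp only [OpenPartialHomeomorph.coe_trans, Function.comp_apply]
    rw [IsOpenEmbedding.toOpenPartialHomeomorph_left_inv]

/-- A hypersurface: a compact oriented topological 1-manifold, possibly with boundary, possibly
empty, not necessarily connected. -/
structure Hyp where
  carrier : Type
  [top : TopologicalSpace carrier]
  [t2 : T2Space carrier]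
  [compact : CompactSpace carrier]
  charts : ∀ x : carrier, ∃ e : OpenPartialHomeomorph carrier (EuclideanHalfSpace 1), x ∈ e.source
  orient : Orient1 carrier

attribute [instance] Hyp.top Hyp.t2 Hyp.compact

namespace Hyp

/-- The manifold interior. -/
def interior (S : Hyp) : Set S.carrier :=
  {x | ∃ e : OpenPartialHomeomorph S.carrier (EuclideanHalfSpace 1), x ∈ e.source ∧ 0 < (e x).1 0}

/-- The empty hypersurface. -/
@[reducible] def empty : Hyp where
  carrier := Empty
  charts x := x.elim
  orient := LocOrient.empty

/-- Orientation reversal. -/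
@[reducible] def rev (S : Hyp) : Hyp where
  carrier := S.carrier
  charts := S.charts
  orient := S.orient.rev

/-- Disjoint union. -/
@[reducible] def sum (S T : Hyp) : Hyp where
  carrier := S.carrier ⊕ T.carrier
  charts := by
    rintro (x | x)
    · obtain ⟨e, he⟩ := S.charts x
      obtain ⟨e', h1, -⟩ := chart_push (IsOpenEmbedding.inl (Y := T.carrier)) e x
      exact ⟨e', h1 ▸ ⟨x, he, rfl⟩⟩
    · obtain ⟨e, he⟩ := T.charts x
      obtain ⟨e', h1, -⟩ := chart_push (IsOpenEmbedding.inr (X := S.carrier)) e x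
      exact ⟨e', h1 ▸ ⟨x, he, rfl⟩⟩
  orient := S.orient.sum T.orient

end Hyp

/-! ### Gluing functions of hypersurfaces -/

/-- A gluing function between hypersurfaces: a closed continuous surjection which is an embedding on
the interior and preserves orientation. -/
@[ext]
structure HGlue (S T : Hyp) where
  toFun : S.carrier → T.carrier
  continuous : Continuous toFun
  surjective : Function.Surjective toFun
  closed : IsClosedMap toFun
  embedding : IsEmbedding (S.interior.domRestrict toFun)
  orient : S.orient.Preserves T.orient toFun

instance (S T : Hyp) : CoeFun (HGlue S T) (fun _ => S.carrier → T.carrier) := ⟨HGlue.toFun⟩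

theorem Hyp.interior_sum_inl {S T : Hyp} {x : S.carrier}
    (h : (Sum.inl x : S.carrier ⊕ T.carrier) ∈ (S.sum T).interior) : x ∈ S.interior := by
  obtain ⟨e, he, h0⟩ := h
  have : Nonempty S.carrier := ⟨x⟩
  refine ⟨((IsOpenEmbedding.inl (Y := T.carrier)).toOpenPartialHomeomorph Sum.inl).trans e, ?_, ?_⟩
  · simpa using he
  · simpa using h0

theorem Hyp.interior_sum_inr {S T : Hyp} {x : T.carrier}
    (h : (Sum.inr x : S.carrier ⊕ T.carrier) ∈ (S.sum T).interior) : x ∈ T.interior := by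
  obtain ⟨e, he, h0⟩ := h
  have : Nonempty T.carrier := ⟨x⟩
  refine ⟨((IsOpenEmbedding.inr (X := S.carrier)).toOpenPartialHomeomorph Sum.inr).trans e, ?_, ?_⟩
  · simpa using he
  · simpa using h0

theorem isEmbedding_sumMap {A B A' B' : Type} [TopologicalSpace A] [TopologicalSpace B]
    [TopologicalSpace A'] [TopologicalSpace B'] {f : A → A'} {g : B → B'} (hf : IsEmbedding f)
    (hg : IsEmbedding g) : IsEmbedding (Sum.map f g) := by
  have h : IsEmbedding (Sum.elim (Sum.inl ∘ f : A → A' ⊕ B') (Sum.inr ∘ g)) := by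
    refine (IsEmbedding.inl.comp hf).sumElim_of_separatedNhds (IsEmbedding.inr.comp hg) ?_
    refine ⟨Set.range Sum.inl, Set.range Sum.inr, isOpen_range_inl, isOpen_range_inr,
      Set.range_comp_subset_range _ _, Set.range_comp_subset_range _ _, ?_⟩
    exact Set.isCompl_range_inl_range_inr.disjoint
  exact h

theorem isEmbedding_sumMap_domRestrict {A B A' B' : Type} [TopologicalSpace A]
    [TopologicalSpace B] [TopologicalSpace A'] [TopologicalSpace B'] {f : A → A'} {g : B → B'}
    {U : Set A} {V : Set B}
    (hU : IsEmbedding (U.domRestrict f)) (hV : IsEmbedding (V.domRestrict g)) {W : Set (A ⊕ B)}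
    (hW : ∀ x ∈ W, x ∈ Sum.inl '' U ∨ x ∈ Sum.inr '' V) :
    IsEmbedding (W.domRestrict (Sum.map f g)) := by
  have hfg : IsEmbedding (Sum.map (U.domRestrict f) (V.domRestrict g)) := isEmbedding_sumMap hU hV
  have hval : IsEmbedding (Sum.map Subtype.val Subtype.val : U ⊕ V → A ⊕ B) :=
    isEmbedding_sumMap IsEmbedding.subtypeVal IsEmbedding.subtypeVal
  have hex : ∀ x : W, ∃ y : U ⊕ V, Sum.map Subtype.val Subtype.val y = x.1 := by
    intro x
    rcases hW x.1 x.2 with ⟨y, hy, hxy⟩ | ⟨y, hy, hxy⟩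
    · exact ⟨Sum.inl ⟨y, hy⟩, hxy⟩
    · exact ⟨Sum.inr ⟨y, hy⟩, hxy⟩
  choose k hk using hex
  have hk' : (Sum.map Subtype.val Subtype.val : U ⊕ V → A ⊕ B) ∘ k = Subtype.val := funext hk
  have hkc : Continuous k := by
    rw [hval.continuous_iff, hk']
    exact continuous_subtype_val
  have hke : IsEmbedding k := by
    refine IsEmbedding.of_comp hkc hval.continuous ?_
    rw [hk']
    exact IsEmbedding.subtypeVal
  have heq : W.domRestrict (Sum.map f g) = Sum.map (U.domRestrict f) (V.domRestrict g) ∘ k := by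
    funext x
    have h := hk x
    change Sum.map f g x.1 = _
    rw [← h]
    rcases h' : k x with y | y <;> simp [h']
  rw [heq]
  exact hfg.comp hke

namespace HGlue

theorem mem_interior {S T : Hyp} (f : HGlue S T) {x : S.carrier} (hx : x ∈ S.interior) :
    f x ∈ T.interior := by
  obtain ⟨e, he, h0⟩ := hx
  obtain ⟨e', he'⟩ := T.charts (f x)
  refine ⟨e', he', lt_of_le_of_ne (e' (f x)).2 fun hz => ?_⟩
  -- the curve through `x` with coordinate `c + t`
  set c : ℝ := (e x).1 0 with hc
  let p : ℝ → EuclideanHalfSpace 1 := fun t =>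
    ⟨EuclideanSpace.single 0 (max (c + t) 0), by simp⟩
  have hp : Continuous p := by
    refine Continuous.subtype_mk ?_ _
    have : Continuous fun r : ℝ => (EuclideanSpace.single 0 r : EuclideanSpace ℝ (Fin 1)) := by
      refine (PiLp.continuous_toLp 2 _).comp (continuous_pi fun i => ?_)
      fin_cases i
      simpa using continuous_id'
    exact this.comp (by fun_prop)
  have hp0 : p 0 = e x := by
    apply Subtype.ext
    ext i
    fin_cases i
    simp only [p, add_zero]
    change (EuclideanSpace.single (0 : Fin 1) (max c 0)) 0 = _
    simp [hc]
    exact (e x).2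
  let q : ℝ → S.carrier := fun t => e.symm (p t)
  have hq0 : q 0 = x := by simp only [q, hp0, e.left_inv he]
  have htgt : p 0 ∈ e.target := by rw [hp0]; exact e.map_source he
  have hq : ContinuousAt q 0 :=
    (e.continuousAt_symm htgt).comp hp.continuousAt
  have hU1 : ∀ᶠ t in 𝓝 (0 : ℝ), p t ∈ e.target :=
    hp.continuousAt.eventually (e.open_target.mem_nhds htgt)
  have hU2 : ∀ᶠ t in 𝓝 (0 : ℝ), f (q t) ∈ e'.source := by
    have : ContinuousAt (fun t => f (q t)) 0 := f.continuous.continuousAt.comp hq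
    refine this.eventually (e'.open_source.mem_nhds ?_)
    change f (q 0) ∈ e'.source
    rwa [hq0]
  have hU3 : ∀ᶠ t in 𝓝 (0 : ℝ), 0 < c + t := by
    have : ContinuousAt (fun t : ℝ => c + t) 0 := by fun_prop
    exact this.eventually (lt_mem_nhds (by simpa using h0))
  obtain ⟨ε, hε, hb⟩ := Metric.eventually_nhds_iff_ball.1 (hU1.and (hU2.and hU3))
  have hI : ∀ t ∈ Set.Ioo (-ε) ε, p t ∈ e.target ∧ f (q t) ∈ e'.source ∧ 0 < c + t := by
    intro t ht
    exact hb t (by rw [Metric.mem_ball, Real.dist_eq, sub_zero, abs_lt]; exact ht)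
  let φ : ℝ → ℝ := fun t => (e' (f (q t))).1 0
  have hφc : ContinuousOn φ (Set.Ioo (-ε) ε) := by
    intro t ht
    obtain ⟨h1, h2, -⟩ := hI t ht
    have hqt : ContinuousAt q t := (e.continuousAt_symm h1).comp hp.continuousAt
    have h4 : ContinuousAt (fun t => e' (f (q t))) t :=
      ContinuousAt.comp (f := fun t => f (q t)) (e'.continuousAt h2)
        (f.continuous.continuousAt.comp hqt)
    have h5 : Continuous fun z : EuclideanHalfSpace 1 => z.1 0 :=
      (EuclideanSpace.proj (𝕜 := ℝ) (0 : Fin 1)).continuous.comp continuous_subtype_val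
    exact (h5.continuousAt.comp h4).continuousWithinAt
  have hφi : Set.InjOn φ (Set.Ioo (-ε) ε) := by
    intro s hs t ht hst
    obtain ⟨s1, s2, s3⟩ := hI s hs
    obtain ⟨t1, t2, t3⟩ := hI t ht
    have h1 : e' (f (q s)) = e' (f (q t)) := by
      apply Subtype.ext
      ext i
      fin_cases i
      exact hst
    have h2 : f (q s) = f (q t) := e'.injOn s2 t2 h1
    have hint : ∀ r, p r ∈ e.target → 0 < c + r → q r ∈ S.interior := by
      intro r hr1 hr2
      refine ⟨e, e.map_target hr1, ?_⟩
      simp only [q, e.right_inv hr1, p]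
      change 0 < (EuclideanSpace.single (0 : Fin 1) (max (c + r) 0)) 0
      simp [hr2]
    have h3 : q s = q t := by
      have := f.embedding.injective (a₁ := ⟨q s, hint s s1 s3⟩) (a₂ := ⟨q t, hint t t1 t3⟩) h2
      exact congrArg Subtype.val this
    have h4 : p s = p t := e.symm.injOn s1 t1 h3
    have h5 := congrArg (fun z : EuclideanHalfSpace 1 => z.1 0) h4
    change (EuclideanSpace.single (0 : Fin 1) (max (c + s) 0)) 0 =
      (EuclideanSpace.single (0 : Fin 1) (max (c + t) 0)) 0 at h5
    simp [s3.le, t3.le] at h5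
    exact h5
  have hφ0 : φ 0 = 0 := by
    change (e' (f (q 0))).1 0 = 0
    rw [hq0]; exact hz.symm
  have hφn : ∀ t, 0 ≤ φ t := fun t => (e' (f (q t))).2
  have m0 : (0 : ℝ) ∈ Set.Ioo (-ε) ε := ⟨by linarith, hε⟩
  have m1 : (ε / 2) ∈ Set.Ioo (-ε) ε := ⟨by linarith, by linarith⟩
  have m2 : (-(ε / 2)) ∈ Set.Ioo (-ε) ε := ⟨by linarith, by linarith⟩
  rcases ContinuousOn.strictMonoOn_of_injOn_Ioo (by linarith) hφc hφi with h | h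
  · have := h m2 m0 (by linarith)
    linarith [hφn (-(ε / 2))]
  · have := h m0 m1 (by linarith)
    linarith [hφn (ε / 2)]

/-- An orientation preserving homeomorphism is a gluing function. -/
def ofHomeo {S T : Hyp} (h : S.carrier ≃ₜ T.carrier) (ho : S.orient.Preserves T.orient h) :
    HGlue S T where
  toFun := h
  continuous := h.continuous
  surjective := h.surjective
  closed := h.isClosedMap
  embedding := h.isEmbedding.comp IsEmbedding.subtypeVal
  orient := ho

/-- The identity. -/
def refl (S : Hyp) : HGlue S S :=
  ofHomeo (Homeomorph.refl _) (LocOrient.Preserves.refl _)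

/-- The composite `g ∘ f`. -/
def comp {S T U : Hyp} (g : HGlue T U) (f : HGlue S T) : HGlue S U where
  toFun := g ∘ f
  continuous := g.continuous.comp f.continuous
  surjective := g.surjective.comp f.surjective
  closed := g.closed.comp f.closed
  embedding :=
    g.embedding.comp (f.embedding.codRestrict T.interior fun x => f.mem_interior x.2)
  orient := LocOrient.Preserves.comp f.continuous f.orient g.orient

/-- The orientation reversed gluing function. -/
def rev {S T : Hyp} (f : HGlue S T) : HGlue S.rev T.rev where
  toFun := f.toFun
  continuous := f.continuous
  surjective := f.surjective
  closed := f.closed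
  embedding := f.embedding
  orient := f.orient.rev

/-- Disjoint union of gluing functions. -/
def sumMap {S S' T T' : Hyp} (f : HGlue S S') (g : HGlue T T') : HGlue (S.sum T) (S'.sum T') where
  toFun := Sum.map f g
  continuous := f.continuous.sumMap g.continuous
  surjective := f.surjective.sumMap g.surjective
  closed := f.closed.sumMap g.closed
  embedding := isEmbedding_sumMap_domRestrict f.embedding g.embedding
    fun x hx => by
      rcases x with x | x
      · exact Or.inl ⟨x, Hyp.interior_sum_inl hx, rfl⟩
      · exact Or.inr ⟨x, Hyp.interior_sum_inr hx, rfl⟩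
  orient := LocOrient.preserves_sum
    (LocOrient.Preserves.comp (f := f.toFun) (g := Sum.inl) f.continuous f.orient
      (LocOrient.preserves_inl _ _))
    (LocOrient.Preserves.comp (f := g.toFun) (g := Sum.inr) g.continuous g.orient
      (LocOrient.preserves_inr _ _))

/-- The interchange of the two components of a disjoint union. -/
def swap (S T : Hyp) : HGlue (S.sum T) (T.sum S) :=
  ofHomeo (Homeomorph.sumComm S.carrier T.carrier)
    (LocOrient.preserves_sum (LocOrient.preserves_inr _ _) (LocOrient.preserves_inl _ _))

/-- Rebracketing of a triple disjoint union. -/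
def assoc (S T U : Hyp) : HGlue ((S.sum T).sum U) (S.sum (T.sum U)) :=
  ofHomeo (Homeomorph.sumAssoc S.carrier T.carrier U.carrier)
    (LocOrient.preserves_sum
      (LocOrient.preserves_sum (LocOrient.preserves_inl _ _)
        (LocOrient.Preserves.comp (f := Sum.inl) (g := Sum.inr) continuous_inl
          (LocOrient.preserves_inl _ _) (LocOrient.preserves_inr _ _)))
      (LocOrient.Preserves.comp (f := Sum.inr) (g := Sum.inr) continuous_inr
        (LocOrient.preserves_inr _ _) (LocOrient.preserves_inr _ _)))

/-- Rebracketing of a triple disjoint union, in the other direction. -/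
def assocSymm (S T U : Hyp) : HGlue (S.sum (T.sum U)) ((S.sum T).sum U) :=
  ofHomeo (Homeomorph.sumAssoc S.carrier T.carrier U.carrier).symm
    (LocOrient.preserves_sum
      (LocOrient.Preserves.comp (f := Sum.inl) (g := Sum.inl) continuous_inl
        (LocOrient.preserves_inl _ _) (LocOrient.preserves_inl _ _))
      (LocOrient.preserves_sum
        (LocOrient.Preserves.comp (f := Sum.inr) (g := Sum.inl) continuous_inr
          (LocOrient.preserves_inr _ _) (LocOrient.preserves_inl _ _))
        (LocOrient.preserves_inr _ _)))

/-- The interchange of the first two components of a triple disjoint union. -/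
def leftComm (S T U : Hyp) : HGlue (S.sum (T.sum U)) (T.sum (S.sum U)) :=
  (assoc T S U).comp (((swap S T).sumMap (refl U)).comp (assocSymm S T U))

end HGlue

/-! ### Regions -/

/-- A region: a compact oriented topological 2-manifold with boundary, together with its boundary
hypersurface `bd` and the inclusion of the latter. The boundary carries the induced orientation: a
positive disc meeting the boundary along an arc of its counterclockwise rim induces a positive
boundary arc. -/
structure Region where
  carrier : Type
  [top : TopologicalSpace carrier]
  [t2 : T2Space carrier]
  [compact : CompactSpace carrier]
  bd : Hyp
  incl : bd.carrier → carrier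
  incl_continuous : Continuous incl
  incl_injective : Function.Injective incl
  charts : ∀ x : carrier, ∃ e : OpenPartialHomeomorph carrier (EuclideanHalfSpace 2),
    x ∈ e.source ∧ ∀ y ∈ e.source, y ∈ Set.range incl ↔ (e y).1 0 = 0
  orient : Orient2 carrier
  bd_orient : ∀ (a : Emb Disc carrier) (b : Emb Arc bd.carrier),
    (∀ t : Arc, a.1 (Disc.rim t) = incl (b.1 t)) → (orient.pos a ↔ bd.orient.pos b)

attribute [instance] Region.top Region.t2 Region.compact

namespace Region

/-- The manifold interior. -/
def interior (X : Region) : Set X.carrier := (Set.range X.incl)ᶜ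

/-- The empty region. -/
@[reducible] def empty : Region where
  carrier := Empty
  bd := Hyp.empty
  incl := id
  incl_continuous := continuous_id
  incl_injective := Function.injective_id
  charts x := x.elim
  orient := LocOrient.empty
  bd_orient a := (a.1 Disc.centre).elim

/-- Orientation reversal. -/
@[reducible] def rev (X : Region) : Region where
  carrier := X.carrier
  bd := X.bd.rev
  incl := X.incl
  incl_continuous := X.incl_continuous
  incl_injective := X.incl_injective
  charts := X.charts
  orient := X.orient.rev
  bd_orient a b h := by
    change X.orient.neg a ↔ X.bd.orient.neg b
    rw [X.orient.neg_iff, X.bd.orient.neg_iff, X.bd_orient a b h]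

/-- Disjoint union. -/
@[reducible] def sum (X Y : Region) : Region where
  carrier := X.carrier ⊕ Y.carrier
  bd := X.bd.sum Y.bd
  incl := Sum.map X.incl Y.incl
  incl_continuous := X.incl_continuous.sumMap Y.incl_continuous
  incl_injective := X.incl_injective.sumMap Y.incl_injective
  charts := by
    rintro (x | x)
    · obtain ⟨e, he, hb⟩ := X.charts x
      obtain ⟨e', h1, h2⟩ := chart_push (IsOpenEmbedding.inl (Y := Y.carrier)) e x
      refine ⟨e', h1 ▸ ⟨x, he, rfl⟩, fun y hy => ?_⟩
      rw [h1] at hy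
      obtain ⟨z, hz, rfl⟩ := hy
      rw [h2, ← hb z hz]
      constructor
      · rintro ⟨w | w, hw⟩
        · exact ⟨w, Sum.inl_injective hw⟩
        · exact absurd hw (by simp)
      · rintro ⟨w, rfl⟩
        exact ⟨Sum.inl w, rfl⟩
    · obtain ⟨e, he, hb⟩ := Y.charts x
      obtain ⟨e', h1, h2⟩ := chart_push (IsOpenEmbedding.inr (X := X.carrier)) e x
      refine ⟨e', h1 ▸ ⟨x, he, rfl⟩, fun y hy => ?_⟩
      rw [h1] at hy
      obtain ⟨z, hz, rfl⟩ := hy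
      rw [h2, ← hb z hz]
      constructor
      · rintro ⟨w | w, hw⟩
        · exact absurd hw (by simp)
        · exact ⟨w, Sum.inr_injective hw⟩
      · rintro ⟨w, rfl⟩
        exact ⟨Sum.inr w, rfl⟩
  orient := X.orient.sum Y.orient
  bd_orient a b h := by
    obtain ⟨t₀⟩ := (inferInstance : Nonempty Arc)
    rcases LocOrient.lift_sum a with ⟨a', ha⟩ | ⟨a', ha⟩ <;>
      rcases LocOrient.lift_sum b with ⟨b', hb⟩ | ⟨b', hb⟩
    · have h' : ∀ t : Arc, a'.1 (Disc.rim t) = X.incl (b'.1 t) := fun t => by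
        have := h t
        rw [ha, hb] at this
        exact Sum.inl_injective this
      exact (LocOrient.sumPred_inl ha).trans
        ((X.bd_orient a' b' h').trans (LocOrient.sumPred_inl hb).symm)
    · have := h t₀
      rw [ha, hb] at this
      exact absurd this (by simp)
    · have := h t₀
      rw [ha, hb] at this
      exact absurd this (by simp)
    · have h' : ∀ t : Arc, a'.1 (Disc.rim t) = Y.incl (b'.1 t) := fun t => by
        have := h t
        rw [ha, hb] at this
        exact Sum.inr_injective this
      exact (LocOrient.sumPred_inr ha).trans
        ((Y.bd_orient a' b' h').trans (LocOrient.sumPred_inr hb).symm)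

end Region

/-- A gluing function between regions: a closed continuous surjection which is an embedding on the
interior and preserves orientation. -/
structure RGlue (X Y : Region) where
  toFun : X.carrier → Y.carrier
  continuous : Continuous toFun
  surjective : Function.Surjective toFun
  closed : IsClosedMap toFun
  embedding : IsEmbedding (X.interior.domRestrict toFun)
  orient : X.orient.Preserves Y.orient toFun

instance (X Y : Region) : CoeFun (RGlue X Y) (fun _ => X.carrier → Y.carrier) := ⟨RGlue.toFun⟩


/-! ### Relative gluing diagrams and slice regions -/

/-- A relative gluing diagram: the boundary of `X` is decomposed by `α` into a copy of `S`, a copy of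
`S` with reversed orientation, and a remainder `L`; the gluing function `f : X → X'` is the
coequalizer of the two inclusions of `S`; and `β` decomposes the boundary of `X'` by `L`. -/
structure RelGluing (X X' : Region) (S L : Hyp) where
  α : HGlue (S.sum (S.rev.sum L)) X.bd
  f : RGlue X X'
  β : HGlue L X'.bd
  coequalizes : ∀ x : S.carrier,
    f (X.incl (α (Sum.inl x))) = f (X.incl (α (Sum.inr (Sum.inl x))))
  universal : ∀ (Z : Type) [TopologicalSpace Z] (g : C(X.carrier, Z)),
    (∀ x : S.carrier, g (X.incl (α (Sum.inl x))) = g (X.incl (α (Sum.inr (Sum.inl x))))) →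
      ∃! h : C(X'.carrier, Z), ∀ x, h (f x) = g x
  comm : ∀ l : L.carrier, X'.incl (β l) = f (X.incl (α (Sum.inr (Sum.inr l))))

/-- The gluing triviality condition: gluing `K` along its copy of the reversed `S` to any region `X`
whose boundary is decomposed into `S` and some `G` gives back `X`, and the remaining copy of `S` in
the boundary of `K` takes over the role of `S` in the boundary of `X`. -/
def GluingTrivial (S : Hyp) (K : Region) (s : HGlue (S.rev.sum S) K.bd) : Prop :=
  ∀ (X : Region) (G : Hyp) (β : HGlue (S.sum G) X.bd),
    ∃ 𝒟 : RelGluing (K.sum X) X S (S.sum G), 𝒟.β = β ∧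
      (∀ x, 𝒟.α (Sum.inl x) = Sum.inr (β (Sum.inl x))) ∧
      (∀ x, 𝒟.α (Sum.inr (Sum.inl x)) = Sum.inl (s (Sum.inl x))) ∧
      (∀ x, 𝒟.α (Sum.inr (Sum.inr (Sum.inl x))) = Sum.inl (s (Sum.inr x))) ∧
      (∀ y, 𝒟.α (Sum.inr (Sum.inr (Sum.inr y))) = Sum.inr (β (Sum.inr y)))

/-- `(K, s)` is a slice region on `S`: gluing triviality holds at each of the two ends of `K`, so
that `K` is a unit for gluings along `S` and for gluings along the reversed `S`. -/
def IsSlice (S : Hyp) (K : Region) (s : HGlue (S.rev.sum S) K.bd) : Prop :=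
  GluingTrivial S K s ∧ GluingTrivial S.rev K (s.comp (HGlue.swap S S.rev))

/-- A system of admissible hypersurfaces, regions, gluing functions, relative gluing diagrams and
slice regions. Everything may be admissible. -/
structure Admissibility where
  hyp : Hyp → Prop
  reg : Region → Prop
  glue : ∀ {S T : Hyp}, HGlue S T → Prop
  rel : ∀ {X X' : Region} {S L : Hyp}, RelGluing X X' S L → Prop
  slice : ∀ (S : Hyp) (K : Region), HGlue (S.rev.sum S) K.bd → Prop
  hyp_empty : hyp Hyp.empty
  reg_empty : reg Region.empty
  hyp_bd : ∀ {X}, reg X → hyp X.bd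
  glue_dom : ∀ {S T} {f : HGlue S T}, glue f → hyp S
  glue_cod : ∀ {S T} {f : HGlue S T}, glue f → hyp T
  glue_homeo : ∀ {S T} (f : HGlue S T), hyp S → hyp T → Function.Injective f.toFun → glue f
  glue_comp : ∀ {S T U} {g : HGlue T U} {f : HGlue S T}, glue g → glue f → glue (g.comp f)
  hyp_sum : ∀ {S T}, hyp S → hyp T → hyp (S.sum T)
  hyp_rev : ∀ {S}, hyp S → hyp S.rev
  reg_sum : ∀ {X Y}, reg X → reg Y → reg (X.sum Y)
  reg_rev : ∀ {X}, reg X → reg X.rev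
  glue_sum : ∀ {S S' T T'} {f : HGlue S S'} {g : HGlue T T'}, glue f → glue g → glue (f.sumMap g)
  glue_rev : ∀ {S T} {f : HGlue S T}, glue f → glue f.rev
  rel_components : ∀ {X X' S L} {𝒟 : RelGluing X X' S L}, rel 𝒟 →
    reg X ∧ reg X' ∧ hyp S ∧ hyp L ∧ glue 𝒟.α ∧ glue 𝒟.β
  slice_components : ∀ {S K s}, slice S K s → hyp S ∧ reg K ∧ glue s
  slice_isSlice : ∀ {S K s}, slice S K s → IsSlice S K s
  exists_slice : ∀ {S}, hyp S → ∃ K s, slice S K s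

/-! ### Compositional quantum field theory -/

/-- The sign `(-1) ^ a` of a parity `a`. -/
def sign (a : ZMod 2) : ℂ := (-1) ^ a.val



/-- The data of a compositional quantum field theory. The topology of the Krein spaces `H S` is
recorded by auxiliary Hilbert space structures; the indefinite inner products are `CQFTData.form`
below. The amplitude maps are defined on the subspaces `dom`. If all the spaces `H S` are finite
dimensional, the auxiliary structures are immaterial and `dom S = ⊤`. -/
structure CQFTData where
  H : Hyp → Type u
  [normed : ∀ S, NormedAddCommGroup (H S)]
  [hilbert : ∀ S, InnerProductSpace ℂ (H S)]
  [complete : ∀ S, CompleteSpace (H S)]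
  /-- the even part (`0`) and the odd part (`1`) -/
  part : ∀ S, ZMod 2 → Submodule ℂ (H S)
  dom : ∀ S, Submodule ℂ (H S)
  /-- graded involutions -/
  ι : ∀ S, H S →SL[starRingEnd ℂ] H S.rev
  /-- graded tensor isomorphisms -/
  τ : ∀ S T, H S →L[ℂ] H T →L[ℂ] H (S.sum T)
  /-- graded gluing epimorphisms -/
  γ : ∀ {S T : Hyp}, HGlue S T → H S →L[ℂ] H T
  /-- graded amplitude maps -/
  ρ : ∀ X : Region, dom X.bd →ₗ[ℂ] ℂ
  /-- the identification of the state space of the empty hypersurface with `ℂ` -/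
  unit : H Hyp.empty ≃L[ℂ] ℂ
  /-- gluing anomalies -/
  anomaly : ∀ {X X' : Region} {S L : Hyp}, RelGluing X X' S L → ℂ

attribute [instance] CQFTData.normed CQFTData.hilbert CQFTData.complete

namespace CQFTData

variable (T : CQFTData.{u})

open Classical in
/-- The amplitude map of `X`, extended by zero outside of its domain. -/
def amp (X : Region) (v : T.H X.bd) : ℂ :=
  if h : v ∈ T.dom X.bd then T.ρ X ⟨v, h⟩ else 0

/-- The inner product `⟨v, w⟩ = ev (ι v ⊗ w)` of the state space of `S`, where `ev` is the
evaluation map of the slice region `(K, s)`. -/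
def form {S : Hyp} {K : Region} (s : HGlue (S.rev.sum S) K.bd) (v w : T.H S) : ℂ :=
  T.amp K (T.γ s (T.τ S.rev S (T.ι S v) w))

/-- A homogeneous orthonormal basis of the state space of `S`: `ζ k` has parity `deg k` and square
`sign (sg k)`, and the basis vectors of positive and of negative square span the two closed subspaces
of a decomposition of the state space. -/
structure IsONB {S : Hyp} {K : Region} (s : HGlue (S.rev.sum S) K.bd) {κ : Type u}
    (ζ : κ → T.H S) (deg sg : κ → ZMod 2) : Prop where
  homogeneous : ∀ k, ζ k ∈ T.part S (deg k)
  norm_eq : ∀ k, T.form s (ζ k) (ζ k) = sign (sg k)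
  orthogonal : ∀ k l, k ≠ l → T.form s (ζ k) (ζ l) = 0
  total : (Submodule.span ℂ (ζ '' {k | sg k = 0})).topologicalClosure ⊔
    (Submodule.span ℂ (ζ '' {k | sg k = 1})).topologicalClosure = ⊤

/-- The axioms of a compositional quantum field theory, for the admissible objects. -/
structure IsCQFT (𝒜 : Admissibility) : Prop where
  /-- state spaces are graded -/
  part_isCompl : ∀ S, 𝒜.hyp S → IsCompl (T.part S 0) (T.part S 1)
  part_closed : ∀ S, 𝒜.hyp S → ∀ p, IsClosed (T.part S p : Set (T.H S))
  part_empty : T.part Hyp.empty 0 = ⊤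
  /-- the domains of the amplitudes are dense graded subspaces, respected by all structure maps -/
  dom_dense : ∀ S, 𝒜.hyp S → Dense (T.dom S : Set (T.H S))
  dom_graded : ∀ S, 𝒜.hyp S → T.dom S ≤ T.part S 0 ⊓ T.dom S ⊔ T.part S 1 ⊓ T.dom S
  dom_empty : T.dom Hyp.empty = ⊤
  ι_dom : ∀ S, 𝒜.hyp S → ∀ v ∈ T.dom S, T.ι S v ∈ T.dom S.rev
  τ_dom : ∀ S S₁, 𝒜.hyp S → 𝒜.hyp S₁ → ∀ v ∈ T.dom S, ∀ w ∈ T.dom S₁,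
    T.τ S S₁ v w ∈ T.dom (S.sum S₁)
  γ_dom : ∀ {S S₁} (f : HGlue S S₁), 𝒜.glue f → ∀ v ∈ T.dom S, T.γ f v ∈ T.dom S₁
  /-- graded involutions -/
  ι_graded : ∀ S, 𝒜.hyp S → ∀ p, ∀ v ∈ T.part S p, T.ι S v ∈ T.part S.rev p
  ι_ι : ∀ S, 𝒜.hyp S → ∀ v, T.ι S.rev (T.ι S v) = v
  /-- graded tensor isomorphisms, from the completed tensor product -/
  τ_graded : ∀ S S₁, 𝒜.hyp S → 𝒜.hyp S₁ → ∀ p q, ∀ v ∈ T.part S p, ∀ w ∈ T.part S₁ q,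
    T.τ S S₁ v w ∈ T.part (S.sum S₁) (p + q)
  τ_iso : ∀ S S₁, 𝒜.hyp S → 𝒜.hyp S₁ →
    ∃ e : UniformSpace.Completion (TensorProduct ℂ (T.H S) (T.H S₁)) ≃L[ℂ] T.H (S.sum S₁),
      ∀ v w, e ((TensorProduct.tmul ℂ v w : TensorProduct ℂ (T.H S) (T.H S₁)) :
        UniformSpace.Completion (TensorProduct ℂ (T.H S) (T.H S₁))) = T.τ S S₁ v w
  /-- graded gluing epimorphisms; in finite dimension dense range is surjectivity -/
  γ_graded : ∀ {S S₁} (f : HGlue S S₁), 𝒜.glue f → ∀ p, ∀ v ∈ T.part S p, T.γ f v ∈ T.part S₁ p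
  γ_epi : ∀ {S S₁} (f : HGlue S S₁), 𝒜.glue f → DenseRange (T.γ f)
  γ_homeo : ∀ {S S₁} (f : HGlue S S₁), 𝒜.glue f → Function.Injective f.toFun →
    Function.Bijective (T.γ f)
  γ_refl : ∀ S, 𝒜.hyp S → ∀ v, T.γ (HGlue.refl S) v = v
  /-- graded amplitude maps -/
  ρ_graded : ∀ X, 𝒜.reg X → ∀ v ∈ T.part X.bd 1, T.amp X v = 0
  ρ_empty : ∀ v, T.amp Region.empty v = T.unit v
  /-- associativity of the tensor isomorphisms -/
  τ_assoc : ∀ S₁ S₂ S₃, 𝒜.hyp S₁ → 𝒜.hyp S₂ → 𝒜.hyp S₃ → ∀ a b c,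
    T.γ (HGlue.assoc S₁ S₂ S₃) (T.τ (S₁.sum S₂) S₃ (T.τ S₁ S₂ a b) c) =
      T.τ S₁ (S₂.sum S₃) a (T.τ S₂ S₃ b c)
  /-- associativity of the gluing epimorphisms: commuting squares go to commuting squares -/
  γ_square : ∀ {S S₁ S₂ S₁₂} (f₁ : HGlue S S₁) (f₂ : HGlue S S₂) (g₁ : HGlue S₁ S₁₂)
    (g₂ : HGlue S₂ S₁₂), 𝒜.glue f₁ → 𝒜.glue f₂ → 𝒜.glue g₁ → 𝒜.glue g₂ →
    (∀ x, g₁ (f₁ x) = g₂ (f₂ x)) → ∀ v, T.γ g₁ (T.γ f₁ v) = T.γ g₂ (T.γ f₂ v)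
  /-- tensor isomorphisms and involutions -/
  τ_ι : ∀ S₁ S₂, 𝒜.hyp S₁ → 𝒜.hyp S₂ → ∀ a b,
    T.τ S₁.rev S₂.rev (T.ι S₁ a) (T.ι S₂ b) =
      T.γ (HGlue.swap S₂.rev S₁.rev) (T.ι (S₂.sum S₁) (T.τ S₂ S₁ b a))
  /-- tensor isomorphisms and gluing epimorphisms -/
  γ_τ : ∀ {S₁ S₁' S₂ S₂'} (f₁ : HGlue S₁ S₁') (f₂ : HGlue S₂ S₂'), 𝒜.glue f₁ → 𝒜.glue f₂ →
    ∀ a b, T.γ (f₁.sumMap f₂) (T.τ S₁ S₂ a b) = T.τ S₁' S₂' (T.γ f₁ a) (T.γ f₂ b)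
  /-- gluing epimorphisms and involutions -/
  γ_ι : ∀ {S S'} (f : HGlue S S'), 𝒜.glue f → ∀ v, T.ι S' (T.γ f v) = T.γ f.rev (T.ι S v)
  /-- amplitudes and tensor isomorphisms -/
  ρ_τ : ∀ X₁ X₂, 𝒜.reg X₁ → 𝒜.reg X₂ → ∀ a ∈ T.dom X₁.bd, ∀ b ∈ T.dom X₂.bd,
    T.amp (X₁.sum X₂) (T.τ X₁.bd X₂.bd a b) = T.amp X₁ a * T.amp X₂ b
  /-- amplitudes and involutions -/
  ρ_ι : ∀ X, 𝒜.reg X → ∀ v ∈ T.dom X.bd,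
    T.amp X.rev (T.ι X.bd v) = starRingEnd ℂ (T.amp X v)
  /-- amplitudes and homeomorphisms -/
  ρ_homeo : ∀ {X X'} (f : RGlue X X') (g : HGlue X.bd X'.bd), 𝒜.reg X → 𝒜.reg X' →
    Function.Injective f.toFun → (∀ x, X'.incl (g x) = f (X.incl x)) →
    ∀ v ∈ T.dom X.bd, T.amp X' (T.γ g v) = T.amp X v
  /-- evaluation on slice regions: everywhere defined and non-degenerate -/
  slice_dom : ∀ {S K} {s : HGlue (S.rev.sum S) K.bd}, 𝒜.slice S K s → ∀ a b,
    T.γ s (T.τ S.rev S a b) ∈ T.dom K.bd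
  slice_nondegenerate : ∀ {S K} {s : HGlue (S.rev.sum S) K.bd}, 𝒜.slice S K s →
    ∃ G : T.H S ≃L[ℂ] T.H S, ∀ v w, T.form s v w = inner ℂ (G v) w
  /-- amplitudes and relative gluing diagrams -/
  anomaly_ne_zero : ∀ {X X' S L} (𝒟 : RelGluing X X' S L), 𝒜.rel 𝒟 → T.anomaly 𝒟 ≠ 0
  rel_dom : ∀ {X X' S L} (𝒟 : RelGluing X X' S L), 𝒜.rel 𝒟 → ∀ z, ∀ v ∈ T.dom L,
    T.γ 𝒟.α (T.τ S (S.rev.sum L) z (T.τ S.rev L (T.ι S z) v)) ∈ T.dom X.bd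
  rel_gluing : ∀ {X X' S L} (𝒟 : RelGluing X X' S L), 𝒜.rel 𝒟 →
    ∀ {K} {s : HGlue (S.rev.sum S) K.bd}, 𝒜.slice S K s →
    ∀ {κ : Type u} {ζ : κ → T.H S} {deg sg : κ → ZMod 2}, T.IsONB s ζ deg sg →
    ∀ v ∈ T.dom L,
      HasSum (fun k => T.anomaly 𝒟 * (sign (sg k) *
        T.amp X (T.γ 𝒟.α (T.τ S (S.rev.sum L) (ζ k) (T.τ S.rev L (T.ι S (ζ k)) v)))))
        (T.amp X' (T.γ 𝒟.β v))
  anomaly_trivial : ∀ {X X'} (𝒟 : RelGluing X X' Hyp.empty X.bd), 𝒜.rel 𝒟 →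
    (∀ x, 𝒟.α (Sum.inr (Sum.inr x)) = x) → Function.Injective 𝒟.f.toFun → T.anomaly 𝒟 = 1

/-- The theory is symmetric: the tensor isomorphisms are compatible with the graded flip. -/
def IsSymmetric (𝒜 : Admissibility) : Prop :=
  ∀ S₁ S₂, 𝒜.hyp S₁ → 𝒜.hyp S₂ → ∀ p q, ∀ a ∈ T.part S₁ p, ∀ b ∈ T.part S₂ q,
    T.γ (HGlue.swap S₁ S₂) (T.τ S₁ S₂ a b) = sign (p * q) • T.τ S₂ S₁ b a

end CQFTData

/-! ### Elementary objects in dimension two -/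

/-- A choice of standard objects: an interval `I`, a disc `D` with boundary circle `C = D.bd`, the
gluing of two intervals, the closing of the interval to the circle, and the compatible twists of the
interval and of the circle. -/
structure Elementary where
  I : Hyp
  interval : Nonempty (I.carrier ≃ₜ unitInterval)
  D : Region
  disc : ∃ h : D.carrier ≃ₜ Disc, ∀ x, x ∈ Set.range D.incl ↔ ‖(h x : ℂ)‖ = 1
  glue2 : HGlue (I.sum I) I
  close : HGlue I D.bd
  tw : HGlue I I.rev
  tw_tw : ∀ x, tw (tw x) = x
  tw_glue2 : ∀ x, tw (glue2 x) = glue2 (Sum.swap (Sum.map tw.toFun tw.toFun x))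
  twC : HGlue D.bd D.bd.rev
  twC_twC : ∀ x, twC (twC x) = x
  twC_close : ∀ x, twC (close x) = close (tw x)

namespace Elementary

variable (E : Elementary)

/-- The standard circle. -/
abbrev C : Hyp := E.D.bd

/-- The gluing of four intervals into one, the two rightmost ones being glued at each step. -/
def glue4 : HGlue (E.I.sum (E.I.sum (E.I.sum E.I))) E.I :=
  E.glue2.comp (((HGlue.refl E.I).sumMap E.glue2).comp
    ((HGlue.refl E.I).sumMap ((HGlue.refl E.I).sumMap E.glue2)))

/-- The decomposition of the circle into four intervals `I₁`, `I₂`, `I₃`, `I₄`, the second and the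
third one with reversed orientation, which are arranged along the circle in the order
`I₁`, `I₃`, `I₂`, `I₄`. -/
def alpha : HGlue (E.I.sum (E.I.rev.sum (E.I.rev.sum E.I))) E.C :=
  E.close.comp (E.glue4.comp (((HGlue.refl E.I).sumMap (HGlue.leftComm E.I E.I E.I)).comp
    ((HGlue.refl E.I).sumMap (E.tw.rev.sumMap (E.tw.rev.sumMap (HGlue.refl E.I))))))

/-- The relative gluing diagram `𝒟` glues the disc to itself along `I₁` and the reversed `I₂`, so
that the reversed `I₃` and `I₄` close up to the two ends of the resulting cylinder, whose boundary is
parametrised by `s`. -/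
structure IsCylinderGluing {X' : Region} (𝒟 : RelGluing E.D X' E.I (E.I.rev.sum E.I))
    (s : HGlue (E.C.rev.sum E.C) X'.bd) : Prop where
  α_eq : 𝒟.α = E.alpha
  β_eq : 𝒟.β = s.comp (E.close.rev.sumMap E.close)

variable (T : CQFTData.{u})

/-- The real structure `α_I` of the state space of the interval. -/
def αI : T.H E.I →SL[starRingEnd ℂ] T.H E.I :=
  (T.ι E.I.rev).comp (T.γ E.tw)

/-- The real structure `α_C` of the state space of the circle. -/
def αC : T.H E.C →SL[starRingEnd ℂ] T.H E.C :=
  (T.ι E.C.rev).comp (T.γ E.twC)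

/-- The gluing map from four copies of the state space of the interval to that of the interval. -/
def mul4 (a b c d : T.H E.I) : T.H E.I :=
  T.γ E.glue4 (T.τ E.I _ a (T.τ E.I _ b (T.τ E.I E.I c d)))

end Elementary

end CQFT

end

/-!
The second part rests on the uniqueness of slice regions (`GluingTrivial.exists_homeo`): if `K` is a
unit for gluings along `S` and `K'` is a unit for gluings along the reversed `S`, then both are the
coequalizer of the two inclusions of `S` in their disjoint union, hence they are homeomorphic, and
the homeomorphism respects the boundary decompositions. Consequently their evaluation maps agree
(`CQFTData.IsCQFT.amp_eq_of_gluingTrivial`). This shows that the inner product does not depend on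
the slice region, that it is hermitian (compare a slice region with its orientation reversal), and
that the real structure exchanges its arguments up to a sign (compare a slice region with the one
whose two ends are twisted and exchanged).

That the homeomorphism preserves orientation has to be checked on small pieces only, as the sign of
an embedded arc or disc is that of any smaller arc or disc inside. For this one needs pieces which
lift along the gluing functions. An arc meets only finitely many images of boundary points, so it
contains a smaller arc which lifts. For discs, the seam and the boundary of the glued region are
images of 1-manifolds under maps which are injective away from finitely many points; they cannot
cover a disc, because a disc does not embed into the line
(`Hyp.exists_disc_notMem_range`, `RelGluing.exists_disc_lift`).

The first part is the gluing axiom for the diagram that closes the disc to the cylinder, evaluated on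
`ι v ⊗ v'`. The gluing maps and tensor isomorphisms turn its summands into products of four vectors
in the state space of the interval, and the interchange of the two middle factors gives the sign
(`Elementary.γ_alpha`).
-/

namespace CQFT

open Topology

/-! ### Small arcs and discs -/

/-- A continuous map into the target of a closed surjection lifts if it only meets points with a
single preimage. -/
theorem exists_continuous_lift {A B E : Type} [TopologicalSpace A] [TopologicalSpace B]
    [TopologicalSpace E] {φ : A → B} (hφ : IsClosedMap φ) (a : C(E, B))
    (h : ∀ z, ∃! x, φ x = a z) : ∃ ψ : C(E, A), ∀ z, φ (ψ z) = a z := by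
  choose ψ hψ huniq using h
  refine ⟨⟨ψ, continuous_iff_isClosed.2 fun V hV => ?_⟩, hψ⟩
  have : ψ ⁻¹' V = a ⁻¹' (φ '' V) := by
    ext z
    constructor
    · exact fun hz => ⟨ψ z, hz, hψ z⟩
    · rintro ⟨x, hx, hxz⟩
      rw [Set.mem_preimage, ← huniq z x hxz]
      exact hx
  rw [this]
  exact (hφ V hV).preimage a.continuous

/-- Every nonempty open subset of the model disc contains a scaled and translated copy of the
disc. -/
theorem Disc.exists_shrink {U : Set Disc} (hU : IsOpen U) {z₀ : Disc} (hz : z₀ ∈ U) :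
    ∃ g : Emb Disc Disc, (∃ k : ℤ, 0 < k ∧ Turns g k) ∧ ∀ w, g.1 w ∈ U := by
  obtain ⟨ε, hε, hb⟩ := Metric.isOpen_iff.1 hU z₀ hz
  set r : ℝ := min 1 (ε / 4)
  have hr0 : 0 < r := lt_min one_pos (by linarith)
  have hr1 : r ≤ 1 := min_le_left _ _
  have hr2 : r ≤ ε / 4 := min_le_right _ _
  have hmem : ∀ w : Disc, ((1 - r : ℝ) • (z₀ : ℂ) + r • (w : ℂ)) ∈ Metric.closedBall (0 : ℂ) 1 :=
    fun w => (convex_closedBall (0 : ℂ) 1) z₀.2 w.2 (by linarith) hr0.le (by ring)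
  let g : Disc → Disc := fun w => ⟨(1 - r : ℝ) • (z₀ : ℂ) + r • (w : ℂ), hmem w⟩
  have hg : Continuous g := by
    refine Continuous.subtype_mk ?_ _
    fun_prop
  have hinj : Function.Injective g := by
    intro w w' h
    have h1 : (1 - r : ℝ) • (z₀ : ℂ) + r • (w : ℂ) = (1 - r : ℝ) • (z₀ : ℂ) + r • (w' : ℂ) :=
      congrArg Subtype.val h
    exact Subtype.ext (smul_right_injective ℂ hr0.ne' (add_left_cancel h1))
  refine ⟨⟨⟨g, hg⟩, hinj⟩, ⟨1, one_pos, fun t => t, continuous_id, fun t => ?_, fun t => by simp⟩,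
    fun w => hb ?_⟩
  · have h1 : (g (Disc.rim t) : ℂ) - g Disc.centre = r * Complex.exp (t * Complex.I) := by
      simp [g, Disc.rim, Disc.centre]
    change (g (Disc.rim t) : ℂ) - g Disc.centre =
      ‖(g (Disc.rim t) : ℂ) - g Disc.centre‖ * Complex.exp (t * Complex.I)
    rw [h1]
    simp [Complex.norm_exp_ofReal_mul_I, abs_of_pos hr0]
  · have h1 : (g w : ℂ) - z₀ = r * ((w : ℂ) - z₀) := by
      simp only [g, Complex.real_smul]
      push_cast
      ring
    have h2 : ‖(w : ℂ) - z₀‖ ≤ 2 := by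
      have hw : ‖(w : ℂ)‖ ≤ 1 := mem_closedBall_zero_iff.1 w.2
      have hz0 : ‖(z₀ : ℂ)‖ ≤ 1 := mem_closedBall_zero_iff.1 z₀.2
      linarith [norm_sub_le (w : ℂ) z₀]
    change dist (g w : ℂ) z₀ < ε
    rw [dist_eq_norm, h1, norm_mul, Complex.norm_real, Real.norm_of_nonneg hr0.le]
    nlinarith

/-- Every nonempty open subset of the model arc contains a scaled and translated copy of the
arc. -/
theorem Arc.exists_shrink {U : Set Arc} (hU : IsOpen U) {t₀ : Arc} (ht : t₀ ∈ U) :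
    ∃ g : Emb Arc Arc, StrictMono g.1 ∧ ∀ w, g.1 w ∈ U := by
  obtain ⟨ε, hε, hb⟩ := Metric.isOpen_iff.1 hU t₀ ht
  set r : ℝ := min 1 (ε / 4)
  have hr0 : 0 < r := lt_min one_pos (by linarith)
  have hr1 : r ≤ 1 := min_le_left _ _
  have hr2 : r ≤ ε / 4 := min_le_right _ _
  have hmem : ∀ w : Arc, ((1 - r) * (t₀ : ℝ) + r * (w : ℝ)) ∈ Set.Icc (-1 : ℝ) 1 :=
    fun w => (convex_Icc (-1 : ℝ) 1) t₀.2 w.2 (by linarith) hr0.le (by ring)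
  let g : Arc → Arc := fun w => ⟨(1 - r) * (t₀ : ℝ) + r * (w : ℝ), hmem w⟩
  have hg : Continuous g := by
    refine Continuous.subtype_mk ?_ _
    fun_prop
  have hmono : StrictMono g := by
    intro w w' h
    change (1 - r) * (t₀ : ℝ) + r * (w : ℝ) < (1 - r) * (t₀ : ℝ) + r * (w' : ℝ)
    have : (w : ℝ) < w' := h
    nlinarith
  refine ⟨⟨⟨g, hg⟩, hmono.injective⟩, hmono, fun w => hb ?_⟩
  have h1 : (g w : ℝ) - t₀ = r * ((w : ℝ) - t₀) := by
    simp only [g]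
    ring
  have h2 : |(w : ℝ) - t₀| ≤ 2 := by
    rw [abs_le]
    constructor <;> linarith [w.2.1, w.2.2, t₀.2.1, t₀.2.2]
  change dist (g w : ℝ) t₀ < ε
  rw [Real.dist_eq, h1, abs_mul, abs_of_pos hr0]
  nlinarith

/-- The model disc does not embed into the line: restricted to the boundary circle, a real function
takes the same value at two antipodal points. -/
theorem Disc.not_injective_real (f : C(Disc, ℝ)) : ¬ Function.Injective f := by
  intro hf
  have hrim : Continuous Disc.rim := by
    refine Continuous.subtype_mk ?_ _
    fun_prop
  have hper : Disc.rim (Real.pi + Real.pi) = Disc.rim 0 := by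
    apply Subtype.ext
    change Complex.exp (((Real.pi + Real.pi : ℝ) : ℂ) * Complex.I) = Complex.exp ((0 : ℝ) * _)
    rw [show ((Real.pi + Real.pi : ℝ) : ℂ) * Complex.I = 2 * Real.pi * Complex.I by push_cast; ring,
      Complex.exp_two_pi_mul_I]
    simp
  let φ : ℝ → ℝ := fun t => f (Disc.rim t) - f (Disc.rim (t + Real.pi))
  have hφ : Continuous φ := by
    have h2 : Continuous fun t : ℝ => Disc.rim (t + Real.pi) := hrim.comp (by fun_prop)
    exact (f.continuous.comp hrim).sub (f.continuous.comp h2)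
  have hanti : φ Real.pi = -φ 0 := by
    simp only [φ, hper, zero_add]
    ring
  have h0 : (0 : ℝ) ∈ Set.range φ := by
    rcases le_total (φ 0) 0 with h | h
    · exact mem_range_of_exists_le_of_exists_ge hφ ⟨0, h⟩ ⟨Real.pi, by linarith⟩
    · exact mem_range_of_exists_le_of_exists_ge hφ ⟨Real.pi, by linarith⟩ ⟨0, h⟩
  obtain ⟨t, ht⟩ := h0
  have h1 : Disc.rim t = Disc.rim (t + Real.pi) := hf (sub_eq_zero.1 ht)
  have h2 : Complex.exp (t * Complex.I) = Complex.exp ((t + Real.pi : ℝ) * Complex.I) :=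
    congrArg Subtype.val h1
  rw [show ((t + Real.pi : ℝ) : ℂ) * Complex.I = t * Complex.I + Real.pi * Complex.I by
    push_cast; ring, Complex.exp_add, Complex.exp_pi_mul_I] at h2
  have h3 := Complex.exp_ne_zero (t * Complex.I)
  apply h3
  linear_combination h2 / 2

instance : Infinite Disc :=
  Infinite.of_injective (fun n : ℕ => (⟨((1 / ((n : ℝ) + 1) : ℝ) : ℂ), by
    have h : (0 : ℝ) < (n : ℝ) + 1 := by positivity
    rw [mem_closedBall_zero_iff, Complex.norm_real, Real.norm_of_nonneg (by positivity),
      div_le_one h]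
    linarith [(n.cast_nonneg : (0 : ℝ) ≤ n)]⟩ : Disc)) fun m n h => by
      have h1 : ((1 / ((m : ℝ) + 1) : ℝ) : ℂ) = ((1 / ((n : ℝ) + 1) : ℝ) : ℂ) :=
        congrArg Subtype.val h
      have h2 : (m : ℝ) + 1 = n + 1 := by
        have := Complex.ofReal_injective h1
        rwa [one_div, one_div, inv_inj] at this
      exact_mod_cast add_right_cancel h2

instance : Infinite Arc := (Set.Icc_infinite (by norm_num : (-1 : ℝ) < 1)).to_subtype

/-! ### Hypersurfaces and gluing functions -/

/-- The boundary of a hypersurface is finite, since each chart domain contains at most one boundary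
point. -/
theorem Hyp.finite_compl_interior (S : Hyp) : S.interiorᶜ.Finite := by
  choose e he using S.charts
  obtain ⟨t, ht⟩ := isCompact_univ.elim_finite_subcover (fun x => (e x).source)
    (fun x => (e x).open_source) fun x _ => Set.mem_iUnion.2 ⟨x, he x⟩
  have hone : ∀ x, (S.interiorᶜ ∩ (e x).source).Subsingleton := by
    have hz : ∀ x, ∀ y ∈ S.interiorᶜ ∩ (e x).source, (e x y).1 0 = 0 := fun x y hy =>
      le_antisymm (not_lt.1 fun h => hy.1 ⟨e x, hy.2, h⟩) (e x y).2
    intro x y hy z hz'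
    refine (e x).injOn hy.2 hz'.2 (Subtype.ext ?_)
    ext i
    fin_cases i
    exact (hz x y hy).trans (hz x z hz').symm
  refine (t.finite_toSet.biUnion fun x _ => (hone x).finite).subset fun y hy => ?_
  obtain ⟨x, hx, hxy⟩ := Set.mem_iUnion₂.1 (ht (Set.mem_univ y))
  exact Set.mem_iUnion₂.2 ⟨x, hx, hy, hxy⟩

/-- A disc is not covered by the image of a hypersurface under a map which is injective away from a
finite set. -/
theorem Hyp.exists_disc_notMem_range (S : Hyp) {M : Type} [TopologicalSpace M] [T2Space M]
    {φ : S.carrier → M} (hφ : Continuous φ) {F : Set S.carrier} (hF : F.Finite)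
    (hinj : Set.InjOn φ Fᶜ) (a : Emb Disc M) : ∃ z, a.1 z ∉ Set.range φ := by
  by_contra! hcon
  -- off the finite set, the covered disc would lift to a disc inside a chart of `S`
  have hfin : (a.1 ⁻¹' (φ '' F)).Finite := (hF.image φ).preimage a.2.injOn
  obtain ⟨z₀, hz₀⟩ := hfin.infinite_compl.nonempty
  obtain ⟨g, -, hg⟩ := Disc.exists_shrink hfin.isClosed.isOpen_compl hz₀
  obtain ⟨ψ, hψ⟩ := exists_continuous_lift hφ.isClosedMap (a.comp g).1 fun z => by
    have hout : ∀ x, φ x = (a.comp g).1 z → x ∈ Fᶜ := fun x hx hxF => hg z ⟨x, hxF, hx⟩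
    obtain ⟨x, hx⟩ := hcon (g.1 z)
    exact ⟨x, hx, fun y hy => hinj (hout y hy) (hout x hx) (hy.trans hx.symm)⟩
  have hψi : Function.Injective ψ := fun z w h => (a.comp g).2 (by rw [← hψ, ← hψ, h])
  obtain ⟨e, he⟩ := S.charts (ψ Disc.centre)
  obtain ⟨g', -, hg'⟩ := Disc.exists_shrink (e.open_source.preimage ψ.continuous) he
  have hcoord : Continuous fun z : EuclideanHalfSpace 1 => z.1 0 :=
    (EuclideanSpace.proj (𝕜 := ℝ) (0 : Fin 1)).continuous.comp continuous_subtype_val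
  have hcont : Continuous fun z => (e (ψ (g'.1 z))).1 0 :=
    hcoord.comp (e.continuousOn.comp_continuous (ψ.continuous.comp g'.1.continuous) hg')
  refine Disc.not_injective_real ⟨_, hcont⟩ fun z w h => g'.2 (hψi (e.injOn (hg' z) (hg' w) ?_))
  apply Subtype.ext
  ext i
  fin_cases i
  exact h

namespace HGlue

/-- Only finitely many points share their image with a boundary point. -/
theorem finite_preimage_image_boundary {S T : Hyp} (f : HGlue S T) :
    (f.toFun ⁻¹' (f.toFun '' S.interiorᶜ)).Finite := by
  have h1 : (S.interior ∩ f.toFun ⁻¹' (f.toFun '' S.interiorᶜ)).Finite :=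
    Set.Finite.of_finite_image
      ((S.finite_compl_interior.image f.toFun).subset (by rintro _ ⟨x, hx, rfl⟩; exact hx.2))
      fun x hx y hy h => congrArg Subtype.val
        (f.embedding.injective (a₁ := ⟨x, hx.1⟩) (a₂ := ⟨y, hy.1⟩) h)
  refine (h1.union S.finite_compl_interior).subset fun x hx => ?_
  by_cases hi : x ∈ S.interior
  · exact Or.inl ⟨hi, hx⟩
  · exact Or.inr hi

theorem eq_of_notMem {S T : Hyp} (f : HGlue S T) {x y : S.carrier}
    (hx : f x ∉ f.toFun '' S.interiorᶜ) (h : f y = f x) : y = x := by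
  have hx' : x ∈ S.interior := by_contra fun hi => hx ⟨x, hi, rfl⟩
  have hy' : y ∈ S.interior := by_contra fun hi => hx ⟨y, hi, h⟩
  exact congrArg Subtype.val (f.embedding.injective (a₁ := ⟨y, hy'⟩) (a₂ := ⟨x, hx'⟩) h)

/-- A homeomorphism which intertwines two gluing functions preserves orientation: every arc contains
a smaller one which avoids the images of the boundary points, hence lifts. -/
theorem preserves_of_comp_eq {S B B' : Hyp} (s : HGlue S B) (s' : HGlue S B')
    (g : B.carrier ≃ₜ B'.carrier) (hg : ∀ x, g (s x) = s' x) :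
    B.orient.Preserves B'.orient g := by
  intro a b hab
  have hfin : (a.1 ⁻¹' (s.toFun '' S.interiorᶜ)).Finite :=
    (S.finite_compl_interior.image _).preimage a.2.injOn
  obtain ⟨t₀, ht₀⟩ := hfin.infinite_compl.nonempty
  obtain ⟨k, hk, hkU⟩ := Arc.exists_shrink hfin.isClosed.isOpen_compl ht₀
  obtain ⟨ψ, hψ⟩ := exists_continuous_lift s.closed (a.comp k).1 fun t => by
    obtain ⟨x, hx⟩ := s.surjective ((a.comp k).1 t)
    refine ⟨x, hx, fun y hy => s.eq_of_notMem ?_ (hy.trans hx.symm)⟩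
    rw [hx]
    exact hkU t
  let c : Emb Arc S.carrier := ⟨ψ, fun z w h => (a.comp k).2 (by rw [← hψ, ← hψ, h])⟩
  have h1 := s.orient c (a.comp k) fun t => (hψ t).symm
  have h2 := s'.orient c (b.comp k) fun t => by
    change b.1 (k.1 t) = s' (ψ t)
    rw [hab, ← hg, hψ]
    rfl
  rw [LocOrient.pos_comp] at h1 h2
  tauto

end HGlue

/-! ### Relative gluing diagrams -/

namespace RelGluing

variable {X X' Y Y' : Region} {S L S' L' : Hyp}

/-- Away from a finite set, the image in `X'` of the glued hypersurface `S` has no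
self-intersections. This is tested with maps to the indiscrete space `Prop`, all of which are
continuous. -/
theorem exists_finite_injOn (𝒟 : RelGluing X X' S L) :
    ∃ F : Set S.carrier, F.Finite ∧
      Set.InjOn (fun x => 𝒟.f (X.incl (𝒟.α (Sum.inl x)))) Fᶜ := by
  set B := 𝒟.α.toFun '' (S.sum (S.rev.sum L)).interiorᶜ
  have hfin := 𝒟.α.finite_preimage_image_boundary
  have hi1 : Function.Injective (Sum.inl : S.carrier → (S.sum (S.rev.sum L)).carrier) :=
    Sum.inl_injective
  have hi2 : Function.Injective
      (fun x => Sum.inr (Sum.inl x) : S.carrier → (S.sum (S.rev.sum L)).carrier) :=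
    Sum.inr_injective.comp Sum.inl_injective
  refine ⟨_, (hfin.preimage hi1.injOn).union (hfin.preimage hi2.injOn), fun x hx y hy hxy => ?_⟩
  have hx1 : 𝒟.α (Sum.inl x) ∉ B := fun h => hx (Or.inl h)
  have hx2 : 𝒟.α (Sum.inr (Sum.inl x)) ∉ B := fun h => hx (Or.inr h)
  -- the test map to the indiscrete space: membership in the class of the point `x` of the seam
  let G : X.carrier → Prop := fun p =>
    p = X.incl (𝒟.α (Sum.inl x)) ∨ p = X.incl (𝒟.α (Sum.inr (Sum.inl x)))
  have hG1 : ∀ u : S.carrier, G (X.incl (𝒟.α (Sum.inl u))) ↔ u = x := by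
    intro u
    constructor
    · rintro (h | h)
      · exact Sum.inl_injective (𝒟.α.eq_of_notMem hx1 (X.incl_injective h))
      · exact absurd (𝒟.α.eq_of_notMem hx2 (X.incl_injective h)) (by simp)
    · rintro rfl
      exact Or.inl rfl
  have hG2 : ∀ u : S.carrier, G (X.incl (𝒟.α (Sum.inr (Sum.inl u)))) ↔ u = x := by
    intro u
    constructor
    · rintro (h | h)
      · exact absurd (𝒟.α.eq_of_notMem hx1 (X.incl_injective h)) (by simp)
      · exact Sum.inl_injective (Sum.inr_injective (𝒟.α.eq_of_notMem hx2 (X.incl_injective h)))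
    · rintro rfl
      exact Or.inr rfl
  obtain ⟨h, hh, -⟩ := @RelGluing.universal X X' S L 𝒟 Prop ⊤
    (@ContinuousMap.mk _ _ _ ⊤ G continuous_top) fun u => propext ((hG1 u).trans (hG2 u).symm)
  have e1 : G (X.incl (𝒟.α (Sum.inl x))) = G (X.incl (𝒟.α (Sum.inl y))) := by
    have h1 := hh (X.incl (𝒟.α (Sum.inl x)))
    have h2 := hh (X.incl (𝒟.α (Sum.inl y)))
    change 𝒟.f (X.incl (𝒟.α (Sum.inl x))) = 𝒟.f (X.incl (𝒟.α (Sum.inl y))) at hxy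
    rw [hxy] at h1
    exact h1.symm.trans h2
  exact ((hG1 y).1 (e1 ▸ (hG1 x).2 rfl)).symm

/-- Every disc in the glued region contains a smaller disc which lifts along the gluing function:
neither the boundary of `X'` nor the seam covers a disc. -/
theorem exists_disc_lift (𝒟 : RelGluing X X' S L) (a : Emb Disc X'.carrier) :
    ∃ (g : Emb Disc Disc) (c : Emb Disc X.carrier), (∃ k : ℤ, 0 < k ∧ Turns g k) ∧
      ∀ z, 𝒟.f (c.1 z) = a.1 (g.1 z) := by
  obtain ⟨F, hF, hinj⟩ := 𝒟.exists_finite_injOn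
  have hφ : Continuous fun x : S.carrier => 𝒟.f (X.incl (𝒟.α (Sum.inl x))) :=
    𝒟.f.continuous.comp (X.incl_continuous.comp (𝒟.α.continuous.comp continuous_inl))
  obtain ⟨z₁, hz₁⟩ := X'.bd.exists_disc_notMem_range X'.incl_continuous Set.finite_empty
    X'.incl_injective.injOn a
  obtain ⟨g₁, -, hU₁⟩ := Disc.exists_shrink
    ((isCompact_range X'.incl_continuous).isClosed.isOpen_compl.preimage a.1.continuous) hz₁
  obtain ⟨z₂, hz₂⟩ := S.exists_disc_notMem_range hφ hF hinj (a.comp g₁)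
  obtain ⟨g, hg, hU⟩ := Disc.exists_shrink
    (((isCompact_range X'.incl_continuous).isClosed.isOpen_compl.inter
      (isCompact_range hφ).isClosed.isOpen_compl).preimage a.1.continuous)
      (show g₁.1 z₂ ∈ _ from ⟨hU₁ z₂, hz₂⟩)
  -- on the smaller disc, only interior points of `X` occur as preimages
  have hint : ∀ z p, 𝒟.f p = a.1 (g.1 z) → p ∈ X.interior := by
    rintro z _ hp ⟨y, rfl⟩
    obtain ⟨h1, h2⟩ := hU z
    rw [← hp] at h1 h2
    obtain ⟨x | x | l, rfl⟩ := 𝒟.α.surjective y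
    · exact h2 ⟨x, rfl⟩
    · exact h2 ⟨x, 𝒟.coequalizes x⟩
    · exact h1 ⟨𝒟.β l, 𝒟.comm l⟩
  obtain ⟨ψ, hψ⟩ := exists_continuous_lift 𝒟.f.closed (a.comp g).1 fun z => by
    obtain ⟨p, hp⟩ := 𝒟.f.surjective (a.1 (g.1 z))
    exact ⟨p, hp, fun q hq => congrArg Subtype.val (𝒟.f.embedding.injective
      (a₁ := ⟨q, hint z q hq⟩) (a₂ := ⟨p, hint z p hp⟩) (hq.trans hp.symm))⟩
  exact ⟨g, ⟨ψ, fun z w h => (a.comp g).2 (by rw [← hψ, ← hψ, h])⟩, hg, hψ⟩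

/-- An orientation preserving homeomorphism of the source regions which respects the
identifications of two relative gluing diagrams descends to an orientation preserving homeomorphism
of the glued regions. -/
theorem exists_homeo (𝒟 : RelGluing X X' S L) (ℰ : RelGluing Y Y' S' L')
    (m : X.carrier ≃ₜ Y.carrier) (hm : X.orient.Preserves Y.orient m)
    (h₁ : ∀ x : S.carrier, ℰ.f (m (X.incl (𝒟.α (Sum.inl x)))) =
      ℰ.f (m (X.incl (𝒟.α (Sum.inr (Sum.inl x))))))
    (h₂ : ∀ x : S'.carrier, 𝒟.f (m.symm (Y.incl (ℰ.α (Sum.inl x)))) =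
      𝒟.f (m.symm (Y.incl (ℰ.α (Sum.inr (Sum.inl x)))))) :
    ∃ h : X'.carrier ≃ₜ Y'.carrier, (∀ p, h (𝒟.f p) = ℰ.f (m p)) ∧
      X'.orient.Preserves Y'.orient h := by
  obtain ⟨h, hh, -⟩ := 𝒟.universal Y'.carrier
    ⟨fun p => ℰ.f (m p), ℰ.f.continuous.comp m.continuous⟩ h₁
  obtain ⟨k, hk, -⟩ := ℰ.universal X'.carrier
    ⟨fun p => 𝒟.f (m.symm p), 𝒟.f.continuous.comp m.symm.continuous⟩ h₂
  -- mutually inverse, since both composites fix the images of the surjections `𝒟.f` and `ℰ.f`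
  let H : X'.carrier ≃ₜ Y'.carrier :=
    { toFun := h
      invFun := k
      left_inv := fun p => by
        obtain ⟨q, rfl⟩ := 𝒟.f.surjective p
        rw [hh]
        exact (hk (m q)).trans (congrArg 𝒟.f.toFun (m.symm_apply_apply q))
      right_inv := fun p => by
        obtain ⟨q, rfl⟩ := ℰ.f.surjective p
        rw [hk]
        exact (hh (m.symm q)).trans (congrArg ℰ.f.toFun (m.apply_symm_apply q))
      continuous_toFun := h.continuous
      continuous_invFun := k.continuous }
  refine ⟨H, hh, fun a b hab => ?_⟩
  obtain ⟨g, c, hg, hc⟩ := 𝒟.exists_disc_lift a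
  let c' : Emb Disc Y.carrier := ⟨⟨fun z => m (c.1 z), m.continuous.comp c.1.continuous⟩,
    m.injective.comp c.2⟩
  have e1 := 𝒟.f.orient c (a.comp g) fun z => (hc z).symm
  have e2 := hm c c' fun z => rfl
  have e3 := ℰ.f.orient c' (b.comp g) fun z => by
    change b.1 (g.1 z) = ℰ.f (m (c.1 z))
    rw [hab, ← hc]
    exact hh (c.1 z)
  rw [LocOrient.pos_comp, iff_true_right hg] at e1 e3
  exact e3.trans (e2.trans e1.symm)

/-- The orientation reversed relative gluing diagram. -/
def rev (𝒟 : RelGluing X X' S L) : RelGluing X.rev X'.rev S.rev L.rev where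
  α := 𝒟.α.rev
  f :=
    { toFun := 𝒟.f.toFun
      continuous := 𝒟.f.continuous
      surjective := 𝒟.f.surjective
      closed := 𝒟.f.closed
      embedding := 𝒟.f.embedding
      orient := 𝒟.f.orient.rev }
  β := 𝒟.β.rev
  coequalizes := 𝒟.coequalizes
  universal := 𝒟.universal
  comm := 𝒟.comm

end RelGluing

/-! ### Slice regions -/

namespace GluingTrivial

/-- A unit for gluings along `S` and a unit for gluings along the reversed `S` agree. Both arise as
the coequalizer of the two inclusions of `S` in their disjoint union. -/
theorem exists_homeo {S : Hyp} {K K' : Region} {s : HGlue (S.rev.sum S) K.bd}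
    {s' : HGlue (S.rev.sum S) K'.bd} (h : GluingTrivial S K s)
    (h' : GluingTrivial S.rev K' (s'.comp (HGlue.swap S S.rev))) :
    ∃ (f : RGlue K K') (g : HGlue K.bd K'.bd), Function.Injective f.toFun ∧
      Function.Injective g.toFun ∧ (∀ x, K'.incl (g x) = f (K.incl x)) ∧
      ∀ x, g (s x) = s' x := by
  obtain ⟨𝒟, hβ, h1, h2, h3, h4⟩ := h K' S.rev (s'.comp (HGlue.swap S S.rev))
  obtain ⟨ℰ, hβ', h1', h2', h3', h4'⟩ := h' K S s
  -- up to the interchange of `K` and `K'`, the two diagrams make the same identifications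
  let m : (K'.sum K).carrier ≃ₜ (K.sum K').carrier := Homeomorph.sumComm K'.carrier K.carrier
  have hm : (K'.sum K).orient.Preserves (K.sum K').orient m :=
    LocOrient.preserves_sum (LocOrient.preserves_inr _ _) (LocOrient.preserves_inl _ _)
  obtain ⟨H, hH, hHo⟩ := ℰ.exists_homeo 𝒟 m hm
    (fun x => by
      have e := 𝒟.coequalizes x
      rw [h1, h2] at e
      rw [h1', h2']
      exact e.symm)
    (fun x => by
      have e := ℰ.coequalizes x
      rw [h1', h2'] at e
      rw [h1, h2]
      exact e.symm)
  have hs : ∀ x, H (K.incl (s x)) = K'.incl (s' x) := by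
    rintro (x | x)
    · have e1 := ℰ.comm (Sum.inl x)
      have e2 := 𝒟.comm (Sum.inr x)
      rw [hβ', h3'] at e1
      rw [hβ, h4] at e2
      rw [e1, hH]
      exact e2.symm
    · have e1 := ℰ.comm (Sum.inr x)
      have e2 := 𝒟.comm (Sum.inl x)
      rw [hβ', h4'] at e1
      rw [hβ, h3] at e2
      rw [e1, hH]
      exact e2.symm
  have hK : IsEmbedding K.incl :=
    (K.incl_continuous.isClosedEmbedding K.incl_injective).isEmbedding
  have hK' : IsEmbedding K'.incl :=
    (K'.incl_continuous.isClosedEmbedding K'.incl_injective).isEmbedding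
  have hex : ∀ y, ∃ y', K'.incl y' = H (K.incl y) := fun y => by
    obtain ⟨x, rfl⟩ := s.surjective y
    exact ⟨s' x, (hs x).symm⟩
  have hex' : ∀ y', ∃ y, K.incl y = H.symm (K'.incl y') := fun y' => by
    obtain ⟨x, rfl⟩ := s'.surjective y'
    exact ⟨s x, by rw [← hs, H.symm_apply_apply]⟩
  choose g hg using hex
  choose k hk using hex'
  let G : K.bd.carrier ≃ₜ K'.bd.carrier :=
    { toFun := g
      invFun := k
      left_inv := fun y => K.incl_injective (by rw [hk, hg, H.symm_apply_apply])
      right_inv := fun y => K'.incl_injective (by rw [hg, hk, H.apply_symm_apply])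
      continuous_toFun := by
        rw [hK'.continuous_iff, show K'.incl ∘ g = H ∘ K.incl from funext hg]
        exact H.continuous.comp K.incl_continuous
      continuous_invFun := by
        rw [hK.continuous_iff, show K.incl ∘ k = H.symm ∘ K'.incl from funext hk]
        exact H.symm.continuous.comp K'.incl_continuous }
  have hGs : ∀ x, G (s x) = s' x := fun x => K'.incl_injective ((hg _).trans (hs x))
  exact ⟨⟨H, H.continuous, H.surjective, H.isClosedMap,
      H.isEmbedding.comp IsEmbedding.subtypeVal, hHo⟩,
    HGlue.ofHomeo G (s.preserves_of_comp_eq s' G hGs), H.injective, G.injective, hg, hGs⟩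

theorem rev {S : Hyp} {K : Region} {s : HGlue (S.rev.sum S) K.bd} (h : GluingTrivial S K s) :
    GluingTrivial S.rev K.rev s.rev := by
  intro X G β
  obtain ⟨𝒟, h0, h1, h2, h3, h4⟩ := h X.rev G.rev β.rev
  refine ⟨𝒟.rev, ?_, h1, h2, h3, h4⟩
  change 𝒟.β.rev = β
  rw [h0]
  rfl

/-- Gluing triviality is transported along a homeomorphism of the hypersurface. -/
theorem precomp {S S' : Hyp} {K : Region} {s : HGlue (S.rev.sum S) K.bd}
    (h : GluingTrivial S K s) (t : HGlue S' S) (t' : HGlue S S') (ht : ∀ x, t (t' x) = x)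
    (ht' : ∀ x, t' (t x) = x) : GluingTrivial S' K (s.comp (t.rev.sumMap t)) := by
  intro X G β
  obtain ⟨𝒟, h0, h1, h2, h3, h4⟩ := h X G (β.comp (t'.sumMap (HGlue.refl G)))
  have e1 : ∀ x, 𝒟.α (Sum.inl (t x)) = Sum.inr (β (Sum.inl x)) := fun x => by
    rw [h1]
    change Sum.inr (β (Sum.inl (t' (t x)))) = _
    rw [ht']
  refine ⟨{
    α := 𝒟.α.comp (t.sumMap (t.rev.sumMap (t.sumMap (HGlue.refl G))))
    f := 𝒟.f
    β := β
    coequalizes := fun x => 𝒟.coequalizes (t x)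
    universal := fun Z _ g hg => 𝒟.universal Z g fun x => by
      rw [← ht x]
      exact hg (t' x)
    comm := ?_ }, rfl, e1, fun x => h2 (t x), fun x => h3 (t x), fun y => h4 y⟩
  rintro (x | y)
  · have e := 𝒟.comm (Sum.inl (t x))
    rw [h0] at e
    refine Eq.trans ?_ e
    change _ = X.incl (β (Sum.inl (t' (t x))))
    rw [ht']
  · have e := 𝒟.comm (Sum.inr y)
    rw [h0] at e
    exact e

end GluingTrivial

/-! ### State spaces -/

theorem sign_add (a b : ZMod 2) : sign (a + b) = sign a * sign b := by
  rw [sign, sign, sign, ZMod.val_add, ← neg_one_pow_eq_pow_mod_two, pow_add]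

theorem sign_mul_self (a : ZMod 2) : sign a * sign a = 1 := by
  rw [sign, ← mul_pow]
  simp

namespace CQFTData

variable {T : CQFTData.{u}} {𝒜 : Admissibility}

theorem amp_smul (T : CQFTData.{u}) {X : Region} (c : ℂ) {v : T.H X.bd} (hv : v ∈ T.dom X.bd) :
    T.amp X (c • v) = c * T.amp X v := by
  rw [amp, amp, dif_pos hv, dif_pos (Submodule.smul_mem _ c hv), ← smul_eq_mul, ← map_smul]
  rfl

namespace IsCQFT

/-- Functoriality of the gluing maps, in the form of commuting triangles. -/
theorem γ_triangle (hT : T.IsCQFT 𝒜) {S S₁ S₂ : Hyp} {f : HGlue S S₁} {g : HGlue S₁ S₂}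
    {k : HGlue S S₂} (hf : 𝒜.glue f) (hg : 𝒜.glue g) (hk : 𝒜.glue k)
    (h : ∀ x, g (f x) = k x) (v : T.H S) : T.γ g (T.γ f v) = T.γ k v := by
  have hS₂ := 𝒜.glue_cod hg
  rw [hT.γ_square f k g (HGlue.refl S₂) hf hk hg
    (𝒜.glue_homeo _ hS₂ hS₂ Function.injective_id) h, hT.γ_refl S₂ hS₂]

theorem γ_comp (hT : T.IsCQFT 𝒜) {S S₁ S₂ : Hyp} {g : HGlue S₁ S₂} {f : HGlue S S₁}
    (hg : 𝒜.glue g) (hf : 𝒜.glue f) (v : T.H S) : T.γ (g.comp f) v = T.γ g (T.γ f v) :=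
  (hT.γ_triangle hf hg (𝒜.glue_comp hg hf) (fun _ => rfl) v).symm

theorem γ_leftInverse (hT : T.IsCQFT 𝒜) {S S' : Hyp} {f : HGlue S S'} {g : HGlue S' S}
    (hf : 𝒜.glue f) (hg : 𝒜.glue g) (h : ∀ x, g (f x) = x) (v : T.H S) :
    T.γ g (T.γ f v) = v := by
  have hS := 𝒜.glue_dom hf
  rw [hT.γ_triangle hf hg (𝒜.glue_homeo (HGlue.refl S) hS hS Function.injective_id) h,
    hT.γ_refl S hS]

/-- The graded interchange of the first two factors of a triple tensor product. -/
theorem γ_leftComm (hT : T.IsCQFT 𝒜) (hS : T.IsSymmetric 𝒜) {S₁ S₂ S₃ : Hyp} (h₁ : 𝒜.hyp S₁)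
    (h₂ : 𝒜.hyp S₂) (h₃ : 𝒜.hyp S₃) {p q : ZMod 2} {a : T.H S₁} (ha : a ∈ T.part S₁ p)
    {b : T.H S₂} (hb : b ∈ T.part S₂ q) (c : T.H S₃) :
    T.γ (HGlue.leftComm S₁ S₂ S₃) (T.τ S₁ (S₂.sum S₃) a (T.τ S₂ S₃ b c)) =
      sign (p * q) • T.τ S₂ (S₁.sum S₃) b (T.τ S₁ S₃ a c) := by
  have hswap : 𝒜.glue (HGlue.swap S₁ S₂) := 𝒜.glue_homeo _ (𝒜.hyp_sum h₁ h₂) (𝒜.hyp_sum h₂ h₁)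
    (Homeomorph.injective _)
  have hrefl : 𝒜.glue (HGlue.refl S₃) := 𝒜.glue_homeo _ h₃ h₃ Function.injective_id
  have hassoc : ∀ {S S' S'' : Hyp}, 𝒜.hyp S → 𝒜.hyp S' → 𝒜.hyp S'' →
      𝒜.glue (HGlue.assoc S S' S'') := fun h h' h'' =>
    𝒜.glue_homeo _ (𝒜.hyp_sum (𝒜.hyp_sum h h') h'') (𝒜.hyp_sum h (𝒜.hyp_sum h' h''))
      (Homeomorph.injective _)
  have hassocSymm : 𝒜.glue (HGlue.assocSymm S₁ S₂ S₃) :=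
    𝒜.glue_homeo _ (𝒜.hyp_sum h₁ (𝒜.hyp_sum h₂ h₃)) (𝒜.hyp_sum (𝒜.hyp_sum h₁ h₂) h₃)
      (Homeomorph.injective _)
  have hmid := 𝒜.glue_sum hswap hrefl
  rw [HGlue.leftComm, hT.γ_comp (hassoc h₂ h₁ h₃) (𝒜.glue_comp hmid hassocSymm),
    hT.γ_comp hmid hassocSymm, ← hT.τ_assoc S₁ S₂ S₃ h₁ h₂ h₃,
    hT.γ_leftInverse (hassoc h₁ h₂ h₃) hassocSymm
      (Homeomorph.sumAssoc S₁.carrier S₂.carrier S₃.carrier).symm_apply_apply,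
    hT.γ_τ _ _ hswap hrefl, hT.γ_refl S₃ h₃, hS S₁ S₂ h₁ h₂ p q a ha b hb, map_smul,
    _root_.smul_apply, map_smul, hT.τ_assoc S₂ S₁ S₃ h₂ h₁ h₃]

/-! ### Inner products -/

/-- Regions which are units for gluings along `S` and along the reversed `S`, respectively, have the
same evaluation map, since they are homeomorphic. -/
theorem amp_eq_of_gluingTrivial (hT : T.IsCQFT 𝒜) {S : Hyp} {K K' : Region}
    {s : HGlue (S.rev.sum S) K.bd} {s' : HGlue (S.rev.sum S) K'.bd} (hK : 𝒜.reg K)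
    (hK' : 𝒜.reg K') (hs : 𝒜.glue s) (hs' : 𝒜.glue s') (h : GluingTrivial S K s)
    (h' : GluingTrivial S.rev K' (s'.comp (HGlue.swap S S.rev))) {w : T.H (S.rev.sum S)}
    (hw : T.γ s w ∈ T.dom K.bd) : T.amp K' (T.γ s' w) = T.amp K (T.γ s w) := by
  obtain ⟨f, g, hf, hg, hfg, hgs⟩ := h.exists_homeo h'
  rw [← hT.ρ_homeo f g hK hK' hf hfg _ hw,
    hT.γ_triangle hs (𝒜.glue_homeo g (𝒜.hyp_bd hK) (𝒜.hyp_bd hK') hg) hs' hgs]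

theorem form_eq (hT : T.IsCQFT 𝒜) {S : Hyp} {K K' : Region} {s : HGlue (S.rev.sum S) K.bd}
    {s' : HGlue (S.rev.sum S) K'.bd} (hs : 𝒜.slice S K s) (hs' : 𝒜.slice S K' s')
    (v w : T.H S) : T.form s' v w = T.form s v w :=
  hT.amp_eq_of_gluingTrivial (𝒜.slice_components hs).2.1 (𝒜.slice_components hs').2.1
    (𝒜.slice_components hs).2.2 (𝒜.slice_components hs').2.2 (𝒜.slice_isSlice hs).1
    (𝒜.slice_isSlice hs').2 (hT.slice_dom hs _ _)

/-- Reversing the orientation of a slice region exchanges its ends, so the inner product is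
hermitian. -/
theorem form_conj_symm (hT : T.IsCQFT 𝒜) {S : Hyp} {K : Region} {s : HGlue (S.rev.sum S) K.bd}
    (hs : 𝒜.slice S K s) (v w : T.H S) :
    T.form s w v = starRingEnd ℂ (T.form s v w) := by
  obtain ⟨hS, hK, hsg⟩ := 𝒜.slice_components hs
  have hr := 𝒜.hyp_rev hS
  have hswap : 𝒜.glue (HGlue.swap S.rev S) :=
    𝒜.glue_homeo _ (𝒜.hyp_sum hr hS) (𝒜.hyp_sum hS hr) (Homeomorph.injective _)
  have hswap' : 𝒜.glue (HGlue.swap S S.rev) :=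
    𝒜.glue_homeo _ (𝒜.hyp_sum hS hr) (𝒜.hyp_sum hr hS) (Homeomorph.injective _)
  -- the orientation reversed slice region, with its two ends exchanged
  let s' : HGlue (S.rev.sum S) K.rev.bd :=
    HGlue.comp (T := S.sum S.rev) s.rev (HGlue.swap S.rev S)
  have hs' : 𝒜.glue s' := 𝒜.glue_comp (𝒜.glue_rev hsg) hswap
  have hss : s'.comp (HGlue.swap S S.rev) = s.rev :=
    HGlue.ext (funext fun x => by rcases x with x | x <;> rfl)
  have h1 : T.ι (S.rev.sum S) (T.τ S.rev S (T.ι S v) w) =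
      T.γ (HGlue.swap S.rev S) (T.τ S.rev S (T.ι S w) v) := by
    have e := hT.τ_ι S S.rev hS hr w (T.ι S v)
    rw [hT.ι_ι S hS] at e
    have e' : T.τ S.rev S (T.ι S w) v =
      T.γ (HGlue.swap S S.rev) (T.ι (S.rev.sum S) (T.τ S.rev S (T.ι S v) w)) := e
    rw [e']
    refine (hT.γ_leftInverse hswap' hswap (fun x => ?_) _).symm
    rcases x with x | x <;> rfl
  have h2 : T.amp K.rev (T.γ s' (T.τ S.rev S (T.ι S w) v)) =
      starRingEnd ℂ (T.form s v w) := by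
    rw [form, ← hT.ρ_ι K hK _ (hT.slice_dom hs _ _), hT.γ_ι s hsg, h1]
    exact congrArg _ (hT.γ_comp (𝒜.glue_rev hsg) hswap _)
  rw [← h2]
  refine (hT.amp_eq_of_gluingTrivial hK (𝒜.reg_rev hK) hsg hs' (𝒜.slice_isSlice hs).1 ?_
    (hT.slice_dom hs _ _)).symm
  exact (congrArg (GluingTrivial S.rev K.rev) hss).mpr (𝒜.slice_isSlice hs).1.rev

/-! ### Real structures -/

theorem ι_γ_involutive (hT : T.IsCQFT 𝒜) {S : Hyp} (hS : 𝒜.hyp S) {t : HGlue S S.rev}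
    (ht : ∀ x, t (t x) = x) (v : T.H S) :
    T.ι S.rev (T.γ t (T.ι S.rev (T.γ t v))) = v := by
  have htg : 𝒜.glue t := 𝒜.glue_homeo t hS (𝒜.hyp_rev hS) (Function.Involutive.injective ht)
  rw [hT.γ_ι t htg]
  have e : T.γ t (T.γ t.rev (T.ι S v)) = T.ι S v :=
    hT.γ_leftInverse (𝒜.glue_rev htg) htg ht _
  exact (congrArg _ e).trans (hT.ι_ι S hS v)

/-- Twisting both ends of a slice region and exchanging them gives a slice region, so the real
structure exchanges the arguments of the inner product up to the sign of the symmetric structure. -/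
theorem form_ι_γ (hT : T.IsCQFT 𝒜) (hSym : T.IsSymmetric 𝒜) {S : Hyp} {K : Region}
    {s : HGlue (S.rev.sum S) K.bd} (hs : 𝒜.slice S K s) {t : HGlue S S.rev}
    (ht : ∀ x, t (t x) = x) {p q : ZMod 2} {v w : T.H S} (hv : v ∈ T.part S p)
    (hw : w ∈ T.part S q) :
    T.form s (T.ι S.rev (T.γ t v)) (T.ι S.rev (T.γ t w)) = sign (p * q) * T.form s w v := by
  obtain ⟨hS, hK, hsg⟩ := 𝒜.slice_components hs
  have hr := 𝒜.hyp_rev hS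
  have htg : 𝒜.glue t := 𝒜.glue_homeo t hS hr (Function.Involutive.injective ht)
  have hswap : 𝒜.glue (HGlue.swap S.rev S) :=
    𝒜.glue_homeo _ (𝒜.hyp_sum hr hS) (𝒜.hyp_sum hS hr) (Homeomorph.injective _)
  have hswap' : 𝒜.glue (HGlue.swap S S.rev) :=
    𝒜.glue_homeo _ (𝒜.hyp_sum hS hr) (𝒜.hyp_sum hr hS) (Homeomorph.injective _)
  let tt : HGlue (S.sum S.rev) (S.rev.sum S) := t.sumMap t.rev
  have htt : 𝒜.glue tt := 𝒜.glue_sum htg (𝒜.glue_rev htg)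
  -- the parametrization of the boundary of `K` with both ends twisted and exchanged
  let s' : HGlue (S.rev.sum S) K.bd :=
    HGlue.comp (T := S.sum S.rev) (s.comp (HGlue.swap S S.rev)) (t.rev.sumMap t)
  have hs' : 𝒜.glue s' := 𝒜.glue_comp (𝒜.glue_comp hsg hswap')
    (𝒜.glue_sum (𝒜.glue_rev htg) htg)
  have htriv : GluingTrivial S K s' := (𝒜.slice_isSlice hs).2.precomp t t.rev ht ht
  have h1 : T.γ s (T.τ S.rev S (T.ι S (T.ι S.rev (T.γ t v))) (T.ι S.rev (T.γ t w))) =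
      sign (p * q) • T.γ s' (T.τ S.rev S (T.ι S w) v) := by
    have e1 : T.ι S (T.ι S.rev (T.γ t v)) = T.γ t v := hT.ι_ι S.rev hr (T.γ t v)
    have e2 : T.τ S.rev S (T.γ t v) (T.γ t.rev (T.ι S w)) =
        T.γ tt (T.τ S S.rev v (T.ι S w)) :=
      (hT.γ_τ t t.rev htg (𝒜.glue_rev htg) v (T.ι S w)).symm
    have e3 := hSym S.rev S hr hS q p (T.ι S w) (hT.ι_graded S hS q w hw) v hv
    have e4 : T.τ S S.rev v (T.ι S w) =
        sign (p * q) • T.γ (HGlue.swap S.rev S) (T.τ S.rev S (T.ι S w) v) := by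
      rw [e3, smul_smul, mul_comm q p, sign_mul_self, one_smul]
    rw [e1, hT.γ_ι t htg]
    refine (congrArg (T.γ s) e2).trans ?_
    rw [e4, map_smul, map_smul]
    refine congrArg _ ?_
    rw [hT.γ_triangle htt hsg (𝒜.glue_comp hsg htt) fun _ => rfl]
    refine hT.γ_triangle hswap (𝒜.glue_comp hsg htt) hs' (fun x => ?_) _
    rcases x with x | x <;> rfl
  have h2 : T.γ s' (T.τ S.rev S (T.ι S w) v) ∈ T.dom K.bd := by
    have e := hT.slice_dom hs (T.ι S (T.ι S.rev (T.γ t v))) (T.ι S.rev (T.γ t w))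
    rw [h1] at e
    have e' := Submodule.smul_mem _ (sign (p * q)) e
    rwa [smul_smul, sign_mul_self, one_smul] at e'
  refine (congrArg (T.amp K) h1).trans ?_
  rw [amp_smul T _ h2, form]
  exact congrArg _ (hT.amp_eq_of_gluingTrivial hK hK hs' hsg htriv (𝒜.slice_isSlice hs).2 h2).symm

end IsCQFT
end CQFTData

/-! ### Gluing the disc to a cylinder -/

namespace Elementary

variable {T : CQFTData.{u}} {𝒜 : Admissibility}

/-- The boundary decomposition `E.alpha` sends a vector of the kind that occurs in the gluing axiom
to the product of four vectors on the interval; the interchange of the two middle ones gives the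
sign. -/
theorem γ_alpha (E : Elementary) (hT : T.IsCQFT 𝒜) (hS : T.IsSymmetric 𝒜)
    (h2 : 𝒜.glue E.glue2) (hc : 𝒜.glue E.close) {p q : ZMod 2} {z v : T.H E.I}
    (hz : z ∈ T.part E.I q) (hv : v ∈ T.part E.I p) (v' : T.H E.I) :
    T.γ E.alpha (T.τ E.I (E.I.rev.sum (E.I.rev.sum E.I)) z
        (T.τ E.I.rev (E.I.rev.sum E.I) (T.ι E.I z) (T.τ E.I.rev E.I (T.ι E.I v) v'))) =
      sign (q * p) • T.γ E.close (E.mul4 T z (E.αI T v) (E.αI T z) v') := by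
  have hI := 𝒜.glue_dom hc
  have hr := 𝒜.hyp_rev hI
  have htw : 𝒜.glue E.tw :=
    𝒜.glue_homeo _ hI hr (Function.Involutive.injective E.tw_tw)
  have htr : 𝒜.glue (T := E.I) E.tw.rev := 𝒜.glue_rev htw
  have hid : 𝒜.glue (HGlue.refl E.I) := 𝒜.glue_homeo _ hI hI Function.injective_id
  have hα : ∀ x, T.γ (T := E.I) E.tw.rev (T.ι E.I x) = E.αI T x := fun x =>
    (hT.γ_ι E.tw htw x).symm
  have hpart : ∀ r, ∀ x ∈ T.part E.I r, E.αI T x ∈ T.part E.I r := fun r x hx =>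
    hT.ι_graded _ hr r _ (hT.γ_graded E.tw htw r x hx)
  have hII := 𝒜.hyp_sum hI hI
  have hlc : 𝒜.glue (HGlue.leftComm E.I E.I E.I) :=
    𝒜.glue_homeo _ (𝒜.hyp_sum hI hII) (𝒜.hyp_sum hI hII) (by
      rintro (x | x | x) (y | y | y) h <;> cases h <;> rfl)
  have hg4 : 𝒜.glue E.glue4 := 𝒜.glue_comp h2 (𝒜.glue_comp (𝒜.glue_sum hid h2)
    (𝒜.glue_sum hid (𝒜.glue_sum hid h2)))
  have hA := 𝒜.glue_sum htr hid
  have hB := 𝒜.glue_sum htr hA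
  have hC := 𝒜.glue_sum hid hB
  have hL := 𝒜.glue_sum hid hlc
  have e : T.γ E.alpha = T.γ (E.close.comp (E.glue4.comp
      (((HGlue.refl E.I).sumMap (HGlue.leftComm E.I E.I E.I)).comp
        ((HGlue.refl E.I).sumMap (HGlue.sumMap (S' := E.I) E.tw.rev
          (HGlue.sumMap (S' := E.I) E.tw.rev (HGlue.refl E.I))))))) := rfl
  rw [e, hT.γ_comp hc (𝒜.glue_comp hg4 (𝒜.glue_comp hL hC)),
    hT.γ_comp hg4 (𝒜.glue_comp hL hC), hT.γ_comp hL hC, hT.γ_τ _ _ hid hB, hT.γ_τ _ _ htr hA,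
    hT.γ_τ _ _ htr hid, hT.γ_refl E.I hI, hT.γ_refl E.I hI, hα, hα, hT.γ_τ _ _ hid hlc,
    hT.γ_refl E.I hI, hT.γ_leftComm hS hI hI hI (hpart q z hz) (hpart p v hv), map_smul, map_smul,
    map_smul]
  rfl

end Elementary

end CQFT

theorem mainTheorem7 (𝒜 : CQFT.Admissibility) (T : CQFT.CQFTData.{u}) (hT : T.IsCQFT 𝒜)
    (hS : T.IsSymmetric 𝒜) (E : CQFT.Elementary) (hD : 𝒜.reg E.D) (h2 : 𝒜.glue E.glue2)
    (hc : 𝒜.glue E.close) :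
    (∀ (X' : CQFT.Region) (𝒟 : CQFT.RelGluing E.D X' E.I (E.I.rev.sum E.I))
      (s' : CQFT.HGlue (E.C.rev.sum E.C) X'.bd),
      E.IsCylinderGluing 𝒟 s' → 𝒜.slice E.C X' s' → 𝒜.rel 𝒟 →
      ∀ (K : CQFT.Region) (s : CQFT.HGlue (E.C.rev.sum E.C) K.bd), 𝒜.slice E.C K s →
      ∀ (K₁ : CQFT.Region) (s₁ : CQFT.HGlue (E.I.rev.sum E.I) K₁.bd), 𝒜.slice E.I K₁ s₁ →
      ∀ (κ : Type u) (ζ : κ → T.H E.I) (deg sg : κ → ZMod 2), T.IsONB s₁ ζ deg sg →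
      ∀ (p : ZMod 2) (v v' : T.H E.I), v ∈ T.part E.I p → v ∈ T.dom E.I → v' ∈ T.dom E.I →
        (∀ k, T.γ E.close (E.mul4 T (ζ k) (E.αI T v) (E.αI T (ζ k)) v') ∈ T.dom E.C) ∧
        HasSum (fun k => T.anomaly 𝒟 * (CQFT.sign (sg k + deg k * p) *
            T.amp E.D (T.γ E.close (E.mul4 T (ζ k) (E.αI T v) (E.αI T (ζ k)) v'))))
          (T.form s (T.γ E.close v) (T.γ E.close v'))) ∧
    (∀ ψ, E.αC T (E.αC T ψ) = ψ) ∧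
    (∀ p, ∀ ψ ∈ T.part E.C p, E.αC T ψ ∈ T.part E.C p) ∧
    (∀ (K : CQFT.Region) (s : CQFT.HGlue (E.C.rev.sum E.C) K.bd), 𝒜.slice E.C K s →
      ∀ (p q : ZMod 2), ∀ ψ ∈ T.part E.C p, ∀ η ∈ T.part E.C q,
        T.form s (E.αC T ψ) (E.αC T η) = CQFT.sign (p * q) * T.form s η ψ ∧
        T.form s η ψ = starRingEnd ℂ (T.form s ψ η)) := by
  have hC : 𝒜.hyp E.C := 𝒜.hyp_bd hD
  have hCr := 𝒜.hyp_rev hC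
  have hI := 𝒜.glue_dom hc
  have htC : 𝒜.glue E.twC := 𝒜.glue_homeo _ hC hCr (Function.Involutive.injective E.twC_twC)
  refine ⟨?_, hT.ι_γ_involutive hC E.twC_twC,
    fun p ψ hψ => hT.ι_graded _ hCr p _ (hT.γ_graded E.twC htC p ψ hψ),
    fun K s hs p q ψ hψ η hη =>
      ⟨hT.form_ι_γ hS hs E.twC_twC hψ hη, hT.form_conj_symm hs ψ η⟩⟩
  intro X' 𝒟 s' h𝒟 hs' hrel K s hs K₁ s₁ hs₁ κ ζ deg sg hζ p v v' hv hvd hvd'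
  have hL := hT.τ_dom _ _ (𝒜.hyp_rev hI) hI _ (hT.ι_dom E.I hI v hvd) _ hvd'
  have hterm := fun k => E.γ_alpha hT hS h2 hc (hζ.homogeneous k) hv v'
  have hdom : ∀ k,
      T.γ E.close (E.mul4 T (ζ k) (E.αI T v) (E.αI T (ζ k)) v') ∈ T.dom E.C := by
    intro k
    have e := hT.rel_dom 𝒟 hrel (ζ k) _ hL
    rw [h𝒟.α_eq, hterm] at e
    have e' := Submodule.smul_mem _ (CQFT.sign (deg k * p)) e
    rwa [smul_smul, CQFT.sign_mul_self, one_smul] at e'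
  refine ⟨hdom, ?_⟩
  have hsum := hT.rel_gluing 𝒟 hrel hs₁ hζ _ hL
  have hval : T.amp X' (T.γ 𝒟.β (T.τ E.I.rev E.I (T.ι E.I v) v')) =
      T.form s (T.γ E.close v) (T.γ E.close v') := by
    rw [h𝒟.β_eq, hT.γ_comp (𝒜.slice_components hs').2.2 (𝒜.glue_sum (𝒜.glue_rev hc) hc),
      hT.γ_τ _ _ (𝒜.glue_rev hc) hc, ← hT.γ_ι _ hc]
    exact hT.form_eq hs hs' _ _
  rw [hval] at hsum
  convert hsum using 2 with k
  rw [h𝒟.α_eq, hterm, CQFT.CQFTData.amp_smul T _ (hdom k), CQFT.sign_add, mul_assoc (CQFT.sign (sg k))]
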